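/- **Definitions.** For a complex $n\times n$ matrix $A$ and $\alpha,\beta\subseteq\{1,\dots,n\}$ let $A(\alpha,\beta)$ be the submatrix with rows $\alpha$ and columns $\beta$, and, if $\#\alpha=\#\beta$, let $A[\alpha,\beta]=\det A(\alpha,\beta)$, with $A[\emptyset,\emptyset]=1$. $A$ is *GKK* if $A[\alpha,\alpha]>0$ for all $\alpha$, and $A[\alpha,\beta]A[\beta,\alpha]\ge 0$ whenever $\#\alpha=\#\beta=\#(\alpha\cup\beta)-1$. Let $l(A)$ be the least real eigenvalue of $A$, and $l(A)=\infty$ if $A$ has no real eigenvalue. $A$ is a *$\tau$-matrix* if $l(A)\ge 0$ and $l(A(\alpha,\alpha))\le l(A(\beta,\beta))<\infty$ whenever $\emptyset\ne\beta\subseteq\alpha\subseteq\{1,\dots,n\}$. $A$ is *positive stable* if $\operatorname{Re}\lambda>0$ for every eigenvalue $\lambda$ of $A$. For $k,n\in\mathbb N$ and real $t$, let $A_{n,k,t}$ be the $n\times n$ Toeplitz matrix with first column $(1,1,0,\dots,0)^T$ and first row $(1,\underbrace{0,\dots,0}_{k},a_1^{k,t},a_2^{k,t},\dots)$ (truncated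 to length $n$), where the numbers $a_j^{k,t}$ ($j\ge1$) are uniquely determined by $\det A_{k+j+1,k,t}=t^j$ for all $j\ge 1$. Let $B_k$ be the Toeplitz matrix of order $2k+2$ with first column $(1,1,0,\dots,0)^T$ and first row $(1,\underbrace{0,\dots,0}_{k},(-1)^k,(-1)^k,\underbrace{0,\dots,0}_{k-1})$. **Theorem.** Let $k>20$ be an integer. 1. There is $t_0\in(0,1)$ such that for every $t\in(0,t_0)$ the matrix $A_{2k+2,k,t}$ is a GKK $\tau$-matrix and has an eigenvalue with negative real part. 2. $\lim_{t\to0+}A_{2k+2,k,t}=B_k$, and $B_k$ has an eigenvalue with negative real part. Consequently all of the following conjectures are false: * (Carlson) every GKK matrix is positive stable; * (Engel–Schneider) every nonsingular $\tau$-matrix is positive stable; * (Varga) every GKK matrix $A$ of order $n\ge2$ with $l(A)<\infty$ satisfies $|\arg(\lambda-l(A))|\le\frac{\pi}{2}-\frac{\pi}{n}$ for all eigenvalues $\lambda$ of $A$ (with $\arg 0=0$); likewise the same assertion for every nonsingular $\tau$-matrix $A$ of order $n\ge2$; * (Hershkowitz) every $\tau$-matrix that is GKK is positive stable. -/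

import Mathlib

open scoped ComplexOrder Topology

/-! ### Minors, GKK matrices, `ω`- and `τ`-matrices, stability -/

/-- The submatrix `A(α, β)`, rows indexed by `α` and columns by `β` in increasing order,
for index sets of equal cardinality. -/
def subMat {n : ℕ} (A : Matrix (Fin n) (Fin n) ℂ) (α β : Finset (Fin n))
    (h : α.card = β.card) : Matrix (Fin α.card) (Fin α.card) ℂ :=
  A.submatrix (α.orderEmbOfFin rfl) (β.orderEmbOfFin h.symm)

/-- The minor `A[α, β] = det A(α, β)`. -/
def minorDet {n : ℕ} (A : Matrix (Fin n) (Fin n) ℂ) (α β : Finset (Fin n))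
    (h : α.card = β.card) : ℂ :=
  (subMat A α β h).det

/-- `A` is a `P`-matrix: every principal minor is (real and) positive. -/
def IsPMatrix {n : ℕ} (A : Matrix (Fin n) (Fin n) ℂ) : Prop :=
  ∀ α : Finset (Fin n), 0 < minorDet A α α rfl

/-- `A` is weakly sign-symmetric: `A[α, β] A[β, α] ≥ 0` whenever
`#α = #β = #(α ∪ β) - 1`. -/
def IsWeaklySignSymmetric {n : ℕ} (A : Matrix (Fin n) (Fin n) ℂ) : Prop :=
  ∀ (α β : Finset (Fin n)) (h : α.card = β.card), α.card + 1 = (α ∪ β).card →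
    0 ≤ minorDet A α β h * minorDet A β α h.symm

/-- GKK matrices: weakly sign-symmetric `P`-matrices. -/
def IsGKK {n : ℕ} (A : Matrix (Fin n) (Fin n) ℂ) : Prop :=
  IsPMatrix A ∧ IsWeaklySignSymmetric A

/-- The set `σ(A) ∩ ℝ` of real eigenvalues. -/
def realSpectrum {n : ℕ} (A : Matrix (Fin n) (Fin n) ℂ) : Set ℝ :=
  {x : ℝ | (x : ℂ) ∈ spectrum ℂ A}

/-- `l(A)`: the least real eigenvalue of `A`, and `∞` if there is none.
(The spectrum is finite, so the infimum over a nonempty set is a minimum;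
the infimum over the empty set in `EReal` is `⊤`.) -/
noncomputable def minRealEig {n : ℕ} (A : Matrix (Fin n) (Fin n) ℂ) : EReal :=
  sInf ((fun x : ℝ => (x : EReal)) '' realSpectrum A)

/-- `ω`-matrices (eigenvalue monotonicity): `l(A(α, α)) ≤ l(A(β, β)) < ∞` whenever
`∅ ≠ β ⊆ α`. -/
def IsOmegaMatrix {n : ℕ} (A : Matrix (Fin n) (Fin n) ℂ) : Prop :=
  ∀ α β : Finset (Fin n), β.Nonempty → β ⊆ α →
    minRealEig (subMat A α α rfl) ≤ minRealEig (subMat A β β rfl) ∧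
      minRealEig (subMat A β β rfl) < ⊤

/-- `τ`-matrices: `ω`-matrices with `l(A) ≥ 0`. -/
def IsTauMatrix {n : ℕ} (A : Matrix (Fin n) (Fin n) ℂ) : Prop :=
  IsOmegaMatrix A ∧ 0 ≤ minRealEig A

/-- Positive stability: all eigenvalues lie in the open right half-plane. -/
def IsPositiveStable {n : ℕ} (A : Matrix (Fin n) (Fin n) ℂ) : Prop :=
  ∀ z ∈ spectrum ℂ A, 0 < z.re

/-- Varga's bound: `|arg (z - l(A))| ≤ π/2 - π/n` for all eigenvalues `z`.
(Nothing is required if `l(A) = ∞`.) -/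
def SatisfiesVargaBound {n : ℕ} (A : Matrix (Fin n) (Fin n) ℂ) : Prop :=
  ∀ l : ℝ, IsLeast (realSpectrum A) l →
    ∀ z ∈ spectrum ℂ A, |Complex.arg (z - (l : ℂ))| ≤ Real.pi / 2 - Real.pi / (n : ℝ)

/-! ### The conjectures -/

/-- Carlson: GKK matrices are positive stable. -/
def CarlsonConjecture : Prop :=
  ∀ (n : ℕ) (A : Matrix (Fin n) (Fin n) ℂ), IsGKK A → IsPositiveStable A

/-- Engel and Schneider: nonsingular `τ`-matrices are positive stable. -/
def EngelSchneiderConjecture : Prop :=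
  ∀ (n : ℕ) (A : Matrix (Fin n) (Fin n) ℂ),
    IsTauMatrix A → IsUnit A.det → IsPositiveStable A

/-- Varga's bound for all GKK matrices. The order is at least `2`:
for `n = 1` the bound `π/2 - π/n` is negative. -/
def VargaConjectureGKK : Prop :=
  ∀ (n : ℕ) (A : Matrix (Fin n) (Fin n) ℂ), 2 ≤ n → IsGKK A → SatisfiesVargaBound A

/-- Varga's bound for all nonsingular `τ`-matrices (of order at least `2`). -/
def VargaConjectureTau : Prop :=
  ∀ (n : ℕ) (A : Matrix (Fin n) (Fin n) ℂ), 2 ≤ n → IsTauMatrix A → IsUnit A.det →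
    SatisfiesVargaBound A

/-- Hershkowitz: `τ`-matrices that are also GKK are positive stable. -/
def HershkowitzConjecture : Prop :=
  ∀ (n : ℕ) (A : Matrix (Fin n) (Fin n) ℂ), IsGKK A → IsTauMatrix A → IsPositiveStable A

/-! ### The Toeplitz Hessenberg matrices `A_{n,k,t}` -/

/-- The `n × n` Toeplitz Hessenberg matrix with first column `(1, 1, 0, …, 0)` and first row
`(1, 0, …, 0, a 1, a 2, …)` with `k` zeros, truncated to length `n`. -/
def toepHess (n k : ℕ) (a : ℕ → ℝ) : Matrix (Fin n) (Fin n) ℝ :=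
  fun i j =>
    if (i : ℕ) = j ∨ (i : ℕ) = j + 1 then 1
    else if (i : ℕ) + k < j then a ((j : ℕ) - i - k)
    else 0

/-- The numbers `a_j^{k,t}` (`j ≥ 1`), determined recursively by
`det A_{k+j+1,k,t} = t ^ j`: this determinant equals `D + (-1)^(k+j) a_j`, where `D` is its
value with `a_j` replaced by `0`. See `det_toepHess_coeffA` and `eq_coeffA`. -/
noncomputable def coeffA (k : ℕ) (t : ℝ) (j : ℕ) : ℝ :=
  (-1) ^ (k + j) * (t ^ j -
    (toepHess (k + j + 1) k (fun l => if _h : l < j then coeffA k t l else 0)).det)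
termination_by j

/-- The matrix `A_{n,k,t}`. -/
noncomputable def matA (n k : ℕ) (t : ℝ) : Matrix (Fin n) (Fin n) ℝ :=
  toepHess n k (coeffA k t)

/-- The matrix `B_k`: Toeplitz of order `2k+2` with first column `(1, 1, 0, …, 0)` and first row
`(1, 0, …, 0, (-1)^k, (-1)^k, 0, …, 0)`, with `k` zeros and then `k - 1` zeros. -/
def matB (k : ℕ) : Matrix (Fin (2 * k + 2)) (Fin (2 * k + 2)) ℝ :=
  toepHess (2 * k + 2) k (fun l => if l = 1 ∨ l = 2 then (-1) ^ k else 0)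

/-- A real matrix regarded as a complex one. -/
noncomputable def toComplex {n : ℕ} (A : Matrix (Fin n) (Fin n) ℝ) :
    Matrix (Fin n) (Fin n) ℂ :=
  A.map (fun x : ℝ => (x : ℂ))

theorem det_toepHess_trunc (k j : ℕ) (hj : 1 ≤ j) (a : ℕ → ℝ) :
    (toepHess (k + j + 1) k a).det =
      (toepHess (k + j + 1) k (fun l => if l < j then a l else 0)).det
        + (-1) ^ (k + j) * a j := by
  set M := toepHess (k + j + 1) k (fun l => if l < j then a l else 0) with hM
  have h1 : toepHess (k + j + 1) k a =
      M.updateRow 0 (M 0 + a j • Pi.single (Fin.last (k + j)) (1 : ℝ)) := by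
    ext p q
    by_cases hp : p = 0
    · subst hp
      rw [Matrix.updateRow_self]
      by_cases hq : q = Fin.last (k + j)
      · subst hq
        simp only [hM, toepHess, Pi.add_apply, Pi.smul_apply, Pi.single_eq_same]
        have e1 : ¬ (0 = k + j ∨ 0 = k + j + 1) := by omega
        have e2 : 0 + k < k + j := by omega
        have e3 : k + j - 0 - k = j := by omega
        simp only [Fin.val_zero, Fin.val_last, if_neg e1, if_pos e2, e3]
        simp
      · have hq' : (q : ℕ) < k + j := by
          have := q.2
          have h2 : (q : ℕ) ≠ k + j := fun h => hq (Fin.ext (by simpa using h))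
          omega
        have e : 0 + k < (q : ℕ) → (q : ℕ) - 0 - k < j := by omega
        rw [Pi.add_apply, Pi.smul_apply, Pi.single_eq_of_ne hq, smul_zero, add_zero]
        simp only [hM, toepHess]
        have e0 : ((0 : Fin (k + j + 1)) : ℕ) = 0 := rfl
        rw [e0]
        by_cases hk : 0 + k < (q : ℕ)
        · rw [if_pos hk, if_pos hk, if_pos (e hk)]
        · rw [if_neg hk, if_neg hk]
    · rw [Matrix.updateRow_ne hp]
      have hp' : 0 < (p : ℕ) := by
        rcases Nat.eq_zero_or_pos (p : ℕ) with h | h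
        · exact absurd (Fin.ext (by simpa using h)) hp
        · exact h
      have hq := q.2
      have e : (p : ℕ) + k < q → (q : ℕ) - p - k < j := by omega
      simp only [hM, toepHess]
      split_ifs <;> first | rfl | (exfalso; omega)
  have h2 : (M.submatrix (Fin.succAbove 0) (Fin.succAbove (Fin.last (k + j)))).det = 1 := by
    rw [Matrix.det_of_isUpperTriangular]
    · apply Finset.prod_eq_one
      intro p _
      simp [hM, toepHess]
    · intro p q hpq
      have hpq' : (q : ℕ) < p := hpq
      have e1 : ¬ ((p : ℕ) + 1 = q ∨ (p : ℕ) + 1 = q + 1) := by omega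
      have e2 : ¬ ((p : ℕ) + 1 + k < q) := by omega
      simp only [hM, toepHess, Matrix.submatrix_apply, Fin.succAbove_zero, Fin.succAbove_last,
        Fin.val_succ, Fin.val_castSucc, if_neg e1, if_neg e2]
  rw [h1, Matrix.det_updateRow_add, Matrix.updateRow_eq_self, Matrix.det_updateRow_smul,
    ← Matrix.adjugate_apply, Matrix.adjugate_fin_succ_eq_det_submatrix, h2]
  simp
  ring

/-- The defining property of the `a_j^{k,t}`. -/
theorem det_toepHess_coeffA (k : ℕ) (t : ℝ) (j : ℕ) (hj : 1 ≤ j) :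
    (matA (k + j + 1) k t).det = t ^ j := by
  rw [matA, det_toepHess_trunc k j hj]
  conv_lhs => rw [coeffA.eq_1 k t j]
  simp only [dite_eq_ite]
  rw [← mul_assoc, ← pow_add, ← two_mul, pow_mul]
  norm_num

/-- The defining property determines the `a_j^{k,t}`. -/
theorem eq_coeffA (k : ℕ) (t : ℝ) (a : ℕ → ℝ)
    (h : ∀ j, 1 ≤ j → (toepHess (k + j + 1) k a).det = t ^ j) (j : ℕ) (hj : 1 ≤ j) :
    a j = coeffA k t j := by
  induction j using Nat.strong_induction_on with
  | _ j ih =>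
    have h1 := h j hj
    have h2 := det_toepHess_coeffA k t j hj
    rw [matA] at h2
    rw [det_toepHess_trunc k j hj] at h1 h2
    have h3 : toepHess (k + j + 1) k (fun l => if l < j then a l else 0) =
        toepHess (k + j + 1) k (fun l => if l < j then coeffA k t l else 0) := by
      ext p q
      simp only [toepHess]
      by_cases hpq : (p : ℕ) + k < q
      · by_cases hl : (q : ℕ) - p - k < j
        · simp only [hl, if_true]
          rw [ih _ hl (by omega)]
        · simp only [hl, if_false]
      · simp only [hpq, if_false]
    rw [h3] at h1
    have h4 : ((-1 : ℝ) ^ (k + j)) * a j = (-1) ^ (k + j) * coeffA k t j := by linarith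
    exact mul_left_cancel₀ (pow_ne_zero _ (by norm_num)) h4

/-! Everything rests on computing principal minors. A Toeplitz Hessenberg matrix with unit
subdiagonal becomes block triangular at each gap of an index set, so a principal minor is the
product of leading minors over the maximal intervals. For `A_{n,k,t}` the leading minors are 1 up to
order k+1 and then t, t², …. Hence each principal minor is t to the number of intervals of length
k+2 inside the index set (`hessDet_eq_pow_card_windows`). That number is supermodular, so for t ≤ 1
the Koteljanskii inequalities hold. Sylvester's identity turns them into weak sign symmetry
(`isGKK_of_koteljanskii`).

For the τ-property, subtracting x from the diagonal changes only the constant term of the first row.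
The generating functions H_x of the leading minors of A − x therefore satisfy H_x = H_0 − x X H_0
H_x. All minors are positive for x ≤ 0. Since (1 − tX)H_0 has nonnegative coefficients, the minor of
the next order is nonpositive at the least zero of a given one once that order exceeds k. The least
real zeros thus decrease with the order (`hessSeq_coeffA_zeros`), and the factorization over
intervals carries this to all principal submatrices.

For instability, the characteristic polynomial of `B_k` in μ = 1 − z is, up to a power of μ, the
trinomial μ^N − (N−2)μ + (N−3) with N = k+3. If all its zeros had real part at most 1, its modulus
could not grow when a point is reflected from right to left in the line Re μ = 1. One explicit point
violates this (`exists_trinomial_zero`). As `B_k` is `A_{2k+2,k,0}` and the entries are continuous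
in t, instability persists for small t > 0. -/

/-! ### Sylvester's identity and a criterion for GKK matrices. -/

/-- The determinant of `A` with rows `g`, `a` and columns `g`, `b`. -/
noncomputable def borderedDet {ι γ K : Type*} [Fintype γ] [DecidableEq γ] [CommRing K]
    (A : Matrix ι ι K) (g : γ → ι) (a b : ι) : K :=
  (A.submatrix (Sum.elim g fun _ : Unit => a) (Sum.elim g fun _ : Unit => b)).det

/-- Dividing by the pivot minor turns bordered determinants into entries of the Schur complement,
and the identity becomes the formula for a 2 × 2 determinant. -/
theorem borderedDet_mul_sub {ι γ K : Type*} [Fintype γ] [DecidableEq γ] [Field K]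
    (A : Matrix ι ι K) (g : γ → ι) (hg : (A.submatrix g g).det ≠ 0) (f : Fin 2 → ι) :
    borderedDet A g (f 0) (f 0) * borderedDet A g (f 1) (f 1)
      - borderedDet A g (f 0) (f 1) * borderedDet A g (f 1) (f 0) =
    (A.submatrix g g).det * (A.submatrix (Sum.elim g f) (Sum.elim g f)).det := by
  have := Matrix.invertibleOfIsUnitDet (A.submatrix g g) (isUnit_iff_ne_zero.2 hg)
  set T := A.submatrix g g with hT
  have key : ∀ {κ : Type} [Fintype κ] [DecidableEq κ] (p q : κ → ι),
      (A.submatrix (Sum.elim g p) (Sum.elim g q)).det =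
        T.det * (A.submatrix p q - A.submatrix p g * ⅟T * A.submatrix g q).det := by
    intro κ _ _ p q
    rw [← Matrix.det_fromBlocks₁₁]
    congr 1
    ext (i | i) (j | j) <;> rfl
  let S : ι → ι → K := fun a b =>
    A a b - ∑ y, (∑ x, A a (g x) * (⅟T) x y) * A (g y) b
  have h1 : ∀ a b, borderedDet A g a b = T.det * S a b := by
    intro a b
    rw [borderedDet, key]
    simp [S, Matrix.det_unique, Matrix.mul_apply]
  have h2 : (A.submatrix (Sum.elim g f) (Sum.elim g f)).det =
      T.det * (S (f 0) (f 0) * S (f 1) (f 1) - S (f 0) (f 1) * S (f 1) (f 0)) := by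
    rw [key, Matrix.det_fin_two]
    simp [S, Matrix.mul_apply]
  rw [h2, h1, h1, h1, h1]
  ring

/-- Relabelling rows and columns differently costs a sign in each factor, and the two signs agree.
Products A[α,β]A[β,α] can thus be computed without tracking the order of the indices. -/
theorem det_submatrix_equiv_mul {m n R : Type*} [Fintype m] [DecidableEq m] [Fintype n]
    [DecidableEq n] [CommRing R] (M N : Matrix n n R) (e₁ e₂ : m ≃ n) :
    (M.submatrix e₁ e₂).det * (N.submatrix e₂ e₁).det = M.det * N.det := by
  rw [← Matrix.det_mul, Matrix.submatrix_mul_equiv, Matrix.det_submatrix_equiv_self,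
    Matrix.det_mul]

theorem Finset.exists_sumEquiv_insert {n : ℕ} (γ α : Finset (Fin n)) (i : Fin n) (hi : i ∉ γ)
    (hα : α = insert i γ) (c : ℕ) (hc : α.card = c) :
    ∃ e : Fin c ≃ γ ⊕ Unit,
      (α.orderEmbOfFin hc : Fin c → Fin n) = (Sum.elim (fun x : γ => (x : Fin n)) fun _ => i) ∘ e := by
  subst hα
  let e₁ : γ ⊕ Unit ≃ (insert i γ : Finset (Fin n)) :=
    Equiv.ofBijective (fun x => Sum.elim (fun x : γ => ⟨x, Finset.mem_insert_of_mem x.2⟩)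
      (fun _ => ⟨i, Finset.mem_insert_self _ _⟩) x) (by
      constructor
      · rintro (⟨x, hx⟩ | _) (⟨y, hy⟩ | _) h
        · simpa using h
        · simp only [Sum.elim_inl, Sum.elim_inr, Subtype.mk.injEq] at h
          exact absurd (h ▸ hx) hi
        · simp only [Sum.elim_inl, Sum.elim_inr, Subtype.mk.injEq] at h
          exact absurd (h ▸ hy) hi
        · rfl
      · rintro ⟨x, hx⟩
        rcases Finset.mem_insert.1 hx with h | h
        · exact ⟨Sum.inr (), by simp [h]⟩
        · exact ⟨Sum.inl ⟨x, h⟩, rfl⟩)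
  have he : ∀ y, Sum.elim (fun x : γ => (x : Fin n)) (fun _ => i) y = (e₁ y : Fin n) := by
    rintro (y | y) <;> rfl
  refine ⟨((insert i γ).orderIsoOfFin hc).toEquiv.trans e₁.symm, ?_⟩
  ext x
  simp [he]

theorem minorDet_self_eq_subtype {n : ℕ} (A : Matrix (Fin n) (Fin n) ℂ) (α : Finset (Fin n)) :
    minorDet A α α rfl = (A.submatrix (fun x : α => (x : Fin n)) fun x : α => (x : Fin n)).det := by
  rw [← Matrix.det_submatrix_equiv_self (α.orderIsoOfFin rfl).toEquiv]
  rfl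

/-- Sylvester's identity for the minors occurring in weak sign symmetry. -/
theorem minorDet_insert_mul {n : ℕ} (A : Matrix (Fin n) (Fin n) ℂ) (γ : Finset (Fin n))
    (i j : Fin n) (hi : i ∉ γ) (hj : j ∉ γ) (hij : i ≠ j) (hγ : minorDet A γ γ rfl ≠ 0)
    (h : (insert i γ).card = (insert j γ).card) :
    minorDet A (insert i γ) (insert j γ) h * minorDet A (insert j γ) (insert i γ) h.symm =
      minorDet A (insert i γ) (insert i γ) rfl * minorDet A (insert j γ) (insert j γ) rfl
      - minorDet A γ γ rfl * minorDet A (insert i (insert j γ)) (insert i (insert j γ)) rfl := by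
  set g : γ → Fin n := fun x => x
  have hd : ∀ a, a ∉ γ → minorDet A (insert a γ) (insert a γ) rfl = borderedDet A g a a := by
    intro a ha
    obtain ⟨e, he⟩ := Finset.exists_sumEquiv_insert γ _ a ha rfl _ rfl
    rw [minorDet, subMat, he, borderedDet, ← Matrix.det_submatrix_equiv_self e]
    rfl
  have ho : minorDet A (insert i γ) (insert j γ) h * minorDet A (insert j γ) (insert i γ) h.symm =
      borderedDet A g i j * borderedDet A g j i := by
    obtain ⟨e₁, h₁⟩ := Finset.exists_sumEquiv_insert γ _ i hi rfl _ rfl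
    obtain ⟨e₂, h₂⟩ := Finset.exists_sumEquiv_insert γ _ j hj rfl _ h.symm
    have h3 : minorDet A (insert j γ) (insert i γ) h.symm =
        (A.submatrix ((insert j γ).orderEmbOfFin h.symm) ((insert i γ).orderEmbOfFin rfl)).det := by
      rw [minorDet, subMat]
      -- The two sides enumerate by the cardinality of different sets; generalizing that number to
      -- `c` lets it be substituted.
      have : ∀ (c : ℕ) (hc : (insert j γ).card = c) (hc' : (insert i γ).card = c),
        (A.submatrix ((insert j γ).orderEmbOfFin rfl) ((insert i γ).orderEmbOfFin h)).det =
        (A.submatrix ((insert j γ).orderEmbOfFin hc) ((insert i γ).orderEmbOfFin hc')).det := by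
        intro c hc hc'
        subst hc
        rfl
      exact this _ _ _
    rw [h3, minorDet, subMat, h₁, h₂, borderedDet, borderedDet,
      ← det_submatrix_equiv_mul _ _ e₁ e₂]
    rfl
  rw [ho, hd i hi, hd j hj]
  have h0 := borderedDet_mul_sub A g (by rwa [minorDet_self_eq_subtype] at hγ) ![i, j]
  simp only [Matrix.cons_val_zero, Matrix.cons_val_one] at h0
  rw [minorDet_self_eq_subtype A γ]
  have h4 : minorDet A (insert i (insert j γ)) (insert i (insert j γ)) rfl =
      (A.submatrix (Sum.elim g ![i, j]) (Sum.elim g ![i, j])).det := by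
    rw [minorDet_self_eq_subtype]
    let e : γ ⊕ Fin 2 ≃ (insert i (insert j γ) : Finset (Fin n)) :=
      Equiv.ofBijective (fun x => ⟨Sum.elim g ![i, j] x, by
        rcases x with x | x
        · simp [g]
        · fin_cases x <;> simp⟩) (by
        constructor
        · rintro (⟨x, hx⟩ | x) (⟨y, hy⟩ | y) hxy
          · simpa [g] using hxy
          · fin_cases y <;> simp [g] at hxy <;> subst hxy <;> contradiction
          · fin_cases x <;> simp [g] at hxy <;> subst hxy <;> contradiction
          · fin_cases x <;> fin_cases y <;> simp [hij, hij.symm] at hxy ⊢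
        · rintro ⟨x, hx⟩
          simp only [Finset.mem_insert] at hx
          rcases hx with h | h | h
          · exact ⟨Sum.inr 0, by simp [h]⟩
          · exact ⟨Sum.inr 1, by simp [h]⟩
          · exact ⟨Sum.inl ⟨x, h⟩, rfl⟩)
    rw [← Matrix.det_submatrix_equiv_self e]
    rfl
  rw [h4, ← h0]
  ring

/-- A `P`-matrix whose principal minors satisfy the Koteljanskii inequalities is GKK. -/
theorem isGKK_of_koteljanskii {n : ℕ} (A : Matrix (Fin n) (Fin n) ℂ) (hP : IsPMatrix A)
    (h : ∀ (γ : Finset (Fin n)) (i j : Fin n), i ∉ γ → j ∉ γ → i ≠ j →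
      minorDet A γ γ rfl * minorDet A (insert i (insert j γ)) (insert i (insert j γ)) rfl ≤
      minorDet A (insert i γ) (insert i γ) rfl * minorDet A (insert j γ) (insert j γ) rfl) :
    IsGKK A := by
  refine ⟨hP, fun α β hαβ hu => ?_⟩
  have hi : (α \ β).card = 1 := by
    have h1 := Finset.card_sdiff_add_card α β
    have h2 := Finset.union_comm α β
    omega
  have hj : (β \ α).card = 1 := by
    have h1 := Finset.card_sdiff_add_card β α
    have h2 := Finset.union_comm α β
    rw [h2] at hu
    omega
  obtain ⟨i, hi⟩ := Finset.card_eq_one.1 hi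
  obtain ⟨j, hj⟩ := Finset.card_eq_one.1 hj
  have hα : α = insert i (α ∩ β) := by
    rw [Finset.insert_eq, ← hi, Finset.sdiff_union_inter]
  have hβ : β = insert j (α ∩ β) := by
    rw [Finset.insert_eq, ← hj, Finset.inter_comm, Finset.sdiff_union_inter]
  have hi' : i ∈ α \ β := by simp [hi]
  have hj' : j ∈ β \ α := by simp [hj]
  rw [Finset.mem_sdiff] at hi' hj'
  generalize hγ : α ∩ β = γ at hα hβ
  have hiγ : i ∉ γ := by simp [← hγ, hi'.2]
  have hjγ : j ∉ γ := by simp [← hγ, hj'.2]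
  have hij : i ≠ j := fun e => hi'.2 (e ▸ hj'.1)
  clear hi' hj' hγ hi hj hu
  subst hα hβ
  rw [minorDet_insert_mul A γ i j hiγ hjγ hij (hP γ).ne', sub_nonneg]
  exact h γ i j hiγ hjγ hij

/-! ### Principal minors of Toeplitz Hessenberg matrices. -/

/-- Entries of the infinite Toeplitz Hessenberg matrix with unit subdiagonal and
first row `c`. -/
def hess {R : Type*} [Zero R] [One R] (c : ℕ → R) (i j : ℕ) : R :=
  if i = j + 1 then 1 else if i ≤ j then c (j - i) else 0

/-- The principal minor of the infinite Toeplitz Hessenberg matrix on the index set `S`. -/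
def hessDet {R : Type*} [CommRing R] (c : ℕ → R) (S : Finset ℕ) : R :=
  (Matrix.of fun i j : S => hess c i j).det

/-- The leading principal minors of the infinite Toeplitz Hessenberg matrix. -/
def hessSeq {R : Type*} [CommRing R] (c : ℕ → R) (m : ℕ) : R :=
  (Matrix.of fun i j : Fin m => hess c i j).det

section
variable {R : Type*} [CommRing R] (c : ℕ → R)

theorem hess_add_right (p i j : ℕ) : hess c (i + p) (j + p) = hess c i j := by
  simp only [hess]
  congr 1
  · simp only [eq_iff_iff]; omega
  · congr 1
    · simp
    · congr 1; omega

theorem hess_eq_zero {i j : ℕ} (h : j + 1 < i) : hess c i j = 0 := by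
  rw [hess, if_neg (by omega), if_neg (by omega)]

@[simp] theorem hess_succ_self (i : ℕ) : hess c (i + 1) i = 1 := by simp [hess]

@[simp] theorem hessSeq_zero : hessSeq c 0 = 1 := by simp [hessSeq]

@[simp] theorem hessDet_empty : hessDet c ∅ = 1 := by simp [hessDet]

theorem hessDet_Ico (p m : ℕ) : hessDet c (Finset.Ico p (p + m)) = hessSeq c m := by
  let e : Fin m ≃ Finset.Ico p (p + m) :=
    { toFun := fun i => ⟨i + p, by simp; omega⟩
      invFun := fun x => ⟨x - p, by have := Finset.mem_Ico.1 x.2; omega⟩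
      left_inv := fun i => by simp
      right_inv := fun x => by
        have := Finset.mem_Ico.1 x.2
        apply Subtype.ext
        simp; omega }
  rw [hessDet, hessSeq, ← Matrix.det_submatrix_equiv_self e]
  congr 1
  ext i j
  exact hess_add_right c p i j

/-- A row index above g and a column index below g differ by at least 2, so the entry lies below the
subdiagonal and vanishes; the matrix is block triangular. -/
theorem hessDet_of_gap {S : Finset ℕ} {g : ℕ} (hg : g ∉ S) :
    hessDet c S = hessDet c {x ∈ S | x < g} * hessDet c {x ∈ S | ¬ x < g} := by
  have aux : ∀ (q : ℕ → Prop) [DecidablePred q],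
      (Matrix.toSquareBlockProp (Matrix.of fun i j : S => hess c i j) fun x => q x).det =
        hessDet c {x ∈ S | q x} := by
    intro q _
    let e : (S.filter q) ≃ {x : S // q x} :=
      { toFun := fun x => ⟨⟨x, (Finset.mem_filter.1 x.2).1⟩, (Finset.mem_filter.1 x.2).2⟩
        invFun := fun x => ⟨x.1, Finset.mem_filter.2 ⟨x.1.2, x.2⟩⟩
        left_inv := fun x => rfl
        right_inv := fun x => rfl }
    rw [hessDet, ← Matrix.det_submatrix_equiv_self e]
    rfl
  rw [hessDet, Matrix.twoBlockTriangular_det _ (fun x : S => (x : ℕ) < g), aux (· < g),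
    aux (fun x => ¬ x < g)]
  intro i hi j hj
  have : (i : ℕ) ≠ g := fun h => hg (h ▸ i.2)
  exact hess_eq_zero c (by omega)

/-- Laplace expansion along the first row. -/
theorem hessSeq_succ (m : ℕ) :
    hessSeq c (m + 1) = ∑ j ∈ Finset.range (m + 1), (-1) ^ j * c j * hessSeq c (m - j) := by
  rw [hessSeq, Matrix.det_succ_row_zero, Finset.sum_range]
  refine Finset.sum_congr rfl fun j _ => ?_
  have h1 : hess c ((0 : Fin (m + 1)) : ℕ) (j : ℕ) = c j := by simp [hess]
  rw [Matrix.of_apply, h1]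
  congr 1
  have hlt : ∀ i : Fin m, (i : ℕ) < j → ((j.succAbove i : Fin (m + 1)) : ℕ) = i := by
    intro i hi
    rw [Fin.succAbove_of_castSucc_lt _ _ (by simpa [Fin.lt_def] using hi)]
    rfl
  have hge : ∀ i : Fin m, ¬ (i : ℕ) < j → ((j.succAbove i : Fin (m + 1)) : ℕ) = i + 1 := by
    intro i hi
    rw [Fin.succAbove_of_le_castSucc _ _ (by simpa [Fin.le_def] using hi)]
    rfl
  -- Without row 0 and column j, the first j columns form an upper triangular block with the unit
  -- subdiagonal on its diagonal; the complementary block is a translate of the leading one of order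
  -- m − j.
  rw [Matrix.twoBlockTriangular_det _ (fun x : Fin m => (x : ℕ) < j)]
  · have hone : (Matrix.toSquareBlockProp ((Matrix.of fun i j : Fin (m + 1) => hess c i j).submatrix
        Fin.succ j.succAbove) fun x : Fin m => (x : ℕ) < j).det = 1 := by
      rw [Matrix.det_of_isUpperTriangular]
      · apply Finset.prod_eq_one
        rintro ⟨x, hx⟩ _
        simp [Matrix.toSquareBlockProp, hlt x hx]
      · rintro ⟨x, hx⟩ ⟨y, hy⟩ hxy
        have hxy' : (y : ℕ) < x := hxy
        change hess c (x + 1) (j.succAbove y : Fin (m + 1)) = 0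
        rw [hlt y hy]
        exact hess_eq_zero c (by omega)
    rw [hone, one_mul]
    let e : Fin (m - j) ≃ {x : Fin m // ¬ (x : ℕ) < j} :=
      { toFun := fun i => ⟨⟨i + j, by omega⟩, by simp⟩
        invFun := fun x => ⟨x.1 - j, by have := x.2; have := x.1.2; omega⟩
        left_inv := fun i => by simp
        right_inv := fun x => by
          have := x.2
          apply Subtype.ext; apply Fin.ext
          simp; omega }
    rw [hessSeq, ← Matrix.det_submatrix_equiv_self e]
    congr 1
    ext x y
    change hess c (x + j + 1) (j.succAbove (e y).1 : Fin (m + 1)) = hess c x y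
    rw [hge _ (e y).2]
    exact hess_add_right c (j + 1) x y
  · intro x hx y hy
    simp only [Matrix.submatrix_apply, Matrix.of_apply, hlt y hy, Fin.val_succ]
    exact hess_eq_zero c (by omega)

end

/-- Induction over the maximal intervals of a finite set of natural numbers. -/
theorem Finset.interval_induction {P : Finset ℕ → Prop} (empty : P ∅)
    (step : ∀ (p m : ℕ) (S : Finset ℕ), 0 < m → (∀ x ∈ S, p + m < x) → P S →
      P (Finset.Ico p (p + m) ∪ S)) (S : Finset ℕ) : P S := by
  induction S using Finset.strongInduction with
  | H S ih =>
    rcases S.eq_empty_or_nonempty with rfl | hne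
    · exact empty
    set p := S.min' hne with hp
    have hpS : p ∈ S := S.min'_mem hne
    have hex : ∃ q, p ≤ q ∧ q ∉ S := by
      refine ⟨S.max' hne + 1, ?_, fun h => ?_⟩
      · have := S.le_max' p hpS; omega
      · have := S.le_max' _ h; omega
    classical
    obtain ⟨q, ⟨hpq, hqS⟩, hmin⟩ : ∃ q, (p ≤ q ∧ q ∉ S) ∧ ∀ r < q, ¬ (p ≤ r ∧ r ∉ S) :=
      ⟨Nat.find hex, Nat.find_spec hex, fun r hr => Nat.find_min hex hr⟩
    have hpq' : p < q := lt_of_le_of_ne hpq fun h => hqS (h ▸ hpS)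
    have hS : S = Finset.Ico p (p + (q - p)) ∪ S.filter (q < ·) := by
      ext x
      simp only [Finset.mem_union, Finset.mem_Ico, Finset.mem_filter]
      constructor
      · intro hx
        have h1 : p ≤ x := S.min'_le x hx
        have h2 : x ≠ q := fun h => hqS (h ▸ hx)
        rcases lt_or_gt_of_ne h2 with h | h
        · left; omega
        · exact Or.inr ⟨hx, h⟩
      · rintro (⟨h1, h2⟩ | h)
        · by_contra hx
          exact hmin x (by omega) ⟨h1, hx⟩
        · exact h.1
    rw [hS]
    refine step p (q - p) _ (by omega) ?_ (ih _ ?_)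
    · intro x hx
      have := (Finset.mem_filter.1 hx).2
      omega
    · refine Finset.filter_ssubset.2 ⟨p, hpS, by omega⟩

/-- The strict bound keeps p + m out of the set, so it is a gap at which the minor splits. -/
theorem hessDet_Ico_union {R : Type*} [CommRing R] (c : ℕ → R) (p m : ℕ) (S : Finset ℕ)
    (hS : ∀ x ∈ S, p + m < x) :
    hessDet c (Finset.Ico p (p + m) ∪ S) = hessSeq c m * hessDet c S := by
  have hg : p + m ∉ Finset.Ico p (p + m) ∪ S := by
    simp only [Finset.mem_union, Finset.mem_Ico, not_or]
    exact ⟨by omega, fun h => absurd (hS _ h) (by omega)⟩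
  rw [hessDet_of_gap c hg, ← hessDet_Ico c p m]
  congr 2
  · ext x
    have := hS x
    simp only [Finset.mem_filter, Finset.mem_union, Finset.mem_Ico]
    constructor
    · rintro ⟨h | h, h'⟩
      · exact h
      · have := this h; omega
    · intro h; exact ⟨Or.inl h, h.2⟩
  · ext x
    have := hS x
    simp only [Finset.mem_filter, Finset.mem_union, Finset.mem_Ico]
    constructor
    · rintro ⟨h | h, h'⟩
      · omega
      · exact h
    · intro h; have := this h; exact ⟨Or.inr h, by omega⟩

/-! ### Counting windows. -/

/-- The left ends of the intervals of length `w` contained in `S` (for `0 < w`). -/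
def windows (w : ℕ) (S : Finset ℕ) : Finset ℕ :=
  {p ∈ S | Finset.Ico p (p + w) ⊆ S}

theorem mem_windows {w : ℕ} (hw : 0 < w) {S : Finset ℕ} {p : ℕ} :
    p ∈ windows w S ↔ Finset.Ico p (p + w) ⊆ S := by
  simp only [windows, Finset.mem_filter, and_iff_right_iff_imp]
  intro h
  exact h (by simp [hw])

theorem card_windows_Ico_union {w : ℕ} (hw : 0 < w) (p m : ℕ) (S : Finset ℕ)
    (hS : ∀ x ∈ S, p + m < x) :
    (windows w (Finset.Ico p (p + m) ∪ S)).card = (m + 1 - w) + (windows w S).card := by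
  have h : windows w (Finset.Ico p (p + m) ∪ S) =
      Finset.Ico p (p + (m + 1 - w)) ∪ windows w S := by
    ext x
    rw [Finset.mem_union, mem_windows hw, mem_windows hw, Finset.mem_Ico]
    constructor
    · intro h
      by_cases hx : x < p + m
      · left
        have h1 : x ∈ Finset.Ico p (p + m) ∪ S := h (by simp [hw])
        have h2 : ¬ (p + m < x + w) := by
          intro h2
          have h3 : p + m ∈ Finset.Ico p (p + m) ∪ S := h (by simp; omega)
          simp only [Finset.mem_union, Finset.mem_Ico] at h3
          rcases h3 with h3 | h3
          · omega
          · have := hS _ h3; omega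
        simp only [Finset.mem_union, Finset.mem_Ico] at h1
        rcases h1 with h1 | h1
        · omega
        · have := hS _ h1; omega
      · right
        intro y hy
        have h1 := h hy
        simp only [Finset.mem_union, Finset.mem_Ico] at h1 hy
        rcases h1 with h1 | h1
        · omega
        · exact h1
    · rintro (h | h)
      · intro y hy
        simp only [Finset.mem_union, Finset.mem_Ico] at hy ⊢
        left; omega
      · exact h.trans Finset.subset_union_right
  rw [h, Finset.card_union_of_disjoint]
  · simp
  · rw [Finset.disjoint_left]
    intro x hx hx'
    have := hS x (Finset.mem_filter.1 hx').1
    rw [Finset.mem_Ico] at hx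
    omega

/-- No window crosses a gap, and a run of length m contains m + 1 − w of them (truncated to 0 for
short runs), which is the exponent of its leading minor. -/
theorem hessDet_eq_pow_card_windows {R : Type*} [CommRing R] (c : ℕ → R) {w : ℕ} (hw : 0 < w) (t : R)
    (h : ∀ m, hessSeq c m = t ^ (m + 1 - w)) (S : Finset ℕ) :
    hessDet c S = t ^ (windows w S).card := by
  induction S using Finset.interval_induction with
  | empty => simp [windows]
  | step p m S hm hS ih =>
    rw [hessDet_Ico_union c p m S hS, card_windows_Ico_union hw p m S hS, pow_add, ih, h]

/-- A window lying in both enlarged sets contains neither i nor j, hence lies in S; the rest is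
inclusion–exclusion. -/
theorem card_windows_supermodular {w : ℕ} (hw : 0 < w) (S : Finset ℕ) (i j : ℕ) (hij : i ≠ j) :
    (windows w (insert i S)).card + (windows w (insert j S)).card ≤
      (windows w S).card + (windows w (insert i (insert j S))).card := by
  have mono : ∀ {S T : Finset ℕ}, S ⊆ T → windows w S ⊆ windows w T := by
    intro S T h x hx
    rw [mem_windows hw] at hx ⊢
    exact hx.trans h
  have hinter : windows w (insert i S) ∩ windows w (insert j S) ⊆ windows w S := by
    intro x hx
    rw [Finset.mem_inter, mem_windows hw, mem_windows hw] at hx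
    rw [mem_windows hw]
    intro y hy
    have h1 := hx.1 hy
    have h2 := hx.2 hy
    rw [Finset.mem_insert] at h1 h2
    rcases h1 with rfl | h1
    · exact h2.resolve_left hij
    · exact h1
  have hunion : windows w (insert i S) ∪ windows w (insert j S) ⊆
      windows w (insert i (insert j S)) :=
    Finset.union_subset (mono (Finset.insert_subset_insert i (Finset.subset_insert j S)))
      (mono (Finset.subset_insert i _))
  rw [← Finset.card_inter_add_card_union]
  exact add_le_add (Finset.card_le_card hinter) (Finset.card_le_card hunion)

/-! ### Minors and spectra of the Toeplitz matrices via `hessDet` and `hessSeq`. -/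

/-- The first row `(1 - x, 0, …, 0, a 1, a 2, …)` with `k` zeros. -/
def firstRow {R : Type*} [CommRing R] (k : ℕ) (a : ℕ → R) (x : R) (l : ℕ) : R :=
  if l = 0 then 1 - x else if k < l then a (l - k) else 0

/-- The ring homomorphism `f` covers both the real matrix and its complexification, so that x may be
a real or a complex spectral parameter. -/
theorem toepHess_apply_sub {R : Type*} [CommRing R] (f : ℝ →+* R) (n k : ℕ) (a : ℕ → ℝ) (x : R)
    (i j : Fin n) :
    f (toepHess n k a i j) - (if i = j then x else 0) =
      hess (firstRow k (fun l => f (a l)) x) i j := by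
  simp only [toepHess, hess, firstRow, Fin.ext_iff]
  by_cases h1 : (i : ℕ) = j
  · simp [h1]
  · by_cases h2 : (i : ℕ) = j + 1
    · simp [h2]
    · by_cases h3 : (i : ℕ) + k < j
      · rw [if_neg (by tauto), if_neg h1, if_neg h2, if_pos h3, if_pos (by omega),
          if_neg (by omega), if_pos (by omega), sub_zero]
      · rw [if_neg (by tauto), if_neg h1, if_neg h2, if_neg h3, map_zero, sub_zero]
        split_ifs <;> first | rfl | omega

theorem map_hessDet {R R' : Type*} [CommRing R] [CommRing R'] (f : R →+* R') (k : ℕ) (a : ℕ → R)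
    (x : R) (S : Finset ℕ) :
    hessDet (firstRow k (fun l => f (a l)) (f x)) S = f (hessDet (firstRow k a x) S) := by
  rw [hessDet, hessDet, RingHom.map_det]
  congr 1
  ext i j
  simp only [hess, firstRow, Matrix.of_apply, RingHom.mapMatrix_apply, Matrix.map_apply, apply_ite f,
    map_one, map_zero, map_sub]

theorem mem_spectrum_iff_det_sub {m : Type*} [Fintype m] [DecidableEq m] (M : Matrix m m ℂ) (z : ℂ) :
    z ∈ spectrum ℂ M ↔ (Matrix.of fun i j => M i j - if i = j then z else 0).det = 0 := by
  rw [spectrum.mem_iff, Matrix.isUnit_iff_isUnit_det, isUnit_iff_ne_zero, not_not]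
  have : algebraMap ℂ (Matrix m m ℂ) z - M =
      -(Matrix.of fun i j => M i j - if i = j then z else 0) := by
    ext i j
    simp [Matrix.algebraMap_matrix_apply]
  rw [this, Matrix.det_neg]
  simp

theorem det_toComplex_toepHess_sub (n k : ℕ) (a : ℕ → ℝ) (z : ℂ) :
    (Matrix.of fun i j => toComplex (toepHess n k a) i j - if i = j then z else 0).det =
      hessSeq (firstRow k (fun l => (a l : ℂ)) z) n := by
  rw [hessSeq]
  congr 1
  ext i j
  exact toepHess_apply_sub Complex.ofRealHom n k a z i j

theorem mem_spectrum_toComplex_toepHess (n k : ℕ) (a : ℕ → ℝ) (z : ℂ) :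
    z ∈ spectrum ℂ (toComplex (toepHess n k a)) ↔
      hessSeq (firstRow k (fun l => (a l : ℂ)) z) n = 0 := by
  rw [mem_spectrum_iff_det_sub, det_toComplex_toepHess_sub]

theorem det_subMat_sub (n k : ℕ) (a : ℕ → ℝ) (x : ℝ) (α : Finset (Fin n)) :
    (Matrix.of fun i j => subMat (toComplex (toepHess n k a)) α α rfl i j -
      if i = j then (x : ℂ) else 0).det =
      (hessDet (firstRow k a x) (α.map Fin.valEmbedding) : ℝ) := by
  let e : Fin α.card ≃ α.map Fin.valEmbedding :=
    (α.orderIsoOfFin rfl).toEquiv.trans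
      { toFun := fun x => ⟨x, Finset.mem_map_of_mem Fin.valEmbedding x.2⟩
        invFun := fun x => ⟨⟨x, by
          obtain ⟨y, _, hy⟩ := Finset.mem_map.1 x.2
          exact hy ▸ y.2⟩, by
          obtain ⟨y, hy, hy'⟩ := Finset.mem_map.1 x.2
          have : y = ⟨x, hy' ▸ y.2⟩ := Fin.ext hy'
          exact this ▸ hy⟩
        left_inv := fun x => rfl
        right_inv := fun x => rfl }
  have h := map_hessDet Complex.ofRealHom k a x (α.map Fin.valEmbedding)
  rw [Complex.ofRealHom_eq_coe, Complex.ofRealHom_eq_coe] at h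
  rw [← h, hessDet, ← Matrix.det_submatrix_equiv_self e]
  congr 1
  ext i j
  have h2 := toepHess_apply_sub Complex.ofRealHom n k a (x : ℂ) (α.orderEmbOfFin rfl i)
    (α.orderEmbOfFin rfl j)
  simp only [EmbeddingLike.apply_eq_iff_eq] at h2
  exact h2

theorem mem_realSpectrum_subMat (n k : ℕ) (a : ℕ → ℝ) (x : ℝ) (α : Finset (Fin n)) :
    x ∈ realSpectrum (subMat (toComplex (toepHess n k a)) α α rfl) ↔
      hessDet (firstRow k a x) (α.map Fin.valEmbedding) = 0 := by
  rw [realSpectrum, Set.mem_ofPred_eq, mem_spectrum_iff_det_sub, det_subMat_sub]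
  simp

theorem minorDet_toComplex_toepHess (n k : ℕ) (a : ℕ → ℝ) (α : Finset (Fin n)) :
    minorDet (toComplex (toepHess n k a)) α α rfl =
      (hessDet (firstRow k a 0) (α.map Fin.valEmbedding) : ℝ) := by
  rw [← det_subMat_sub, minorDet]
  congr 1
  ext i j
  simp

theorem mem_realSpectrum_toComplex_toepHess (n k : ℕ) (a : ℕ → ℝ) (x : ℝ) :
    x ∈ realSpectrum (toComplex (toepHess n k a)) ↔ hessSeq (firstRow k a x) n = 0 := by
  have h := map_hessDet Complex.ofRealHom k a x (Finset.Ico 0 (0 + n))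
  rw [Complex.ofRealHom_eq_coe, Complex.ofRealHom_eq_coe, hessDet_Ico, hessDet_Ico] at h
  rw [realSpectrum, Set.mem_ofPred_eq, mem_spectrum_toComplex_toepHess]
  change hessSeq (firstRow k (fun l => Complex.ofRealHom (a l)) (x : ℂ)) n = 0 ↔ _
  rw [h]
  simp

theorem hessSeq_firstRow_eq_one {R : Type*} [CommRing R] (k : ℕ) (a : ℕ → R) (x : R) (m : ℕ)
    (hm : m ≤ k + 1) : hessSeq (firstRow k a x) m = (1 - x) ^ m := by
  induction m with
  | zero => simp
  | succ m ih =>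
    rw [hessSeq_succ, Finset.sum_eq_single 0]
    · simp [ih (by omega), firstRow, pow_succ']
    · intro j hj hj0
      have := Finset.mem_range.1 hj
      simp [firstRow, hj0, show ¬ k < j by omega]
    · simp

theorem hessSeq_coeffA (k : ℕ) (t : ℝ) (m : ℕ) :
    hessSeq (firstRow k (coeffA k t) 0) m = t ^ (m + 1 - (k + 2)) := by
  -- Up to order k + 1 the exponent truncates to 0; beyond it, the normalization of the a_j applies
  -- with j = m − k − 1.
  by_cases hm : m ≤ k + 1
  · rw [hessSeq_firstRow_eq_one k _ _ m hm, show m + 1 - (k + 2) = 0 by omega]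
    simp
  · obtain ⟨j, rfl⟩ : ∃ j, m = k + j + 1 := ⟨m - k - 1, by omega⟩
    rw [show k + j + 1 + 1 - (k + 2) = j by omega, ← det_toepHess_coeffA k t j (by omega), matA,
      hessSeq]
    congr 1
    ext i j
    have := toepHess_apply_sub (RingHom.id ℝ) _ k (coeffA k t) 0 i j
    simpa using this.symm

/-- The matrices `A_{n,k,t}` are GKK for all `t ∈ (0, 1]`. -/
theorem isGKK_matA (n k : ℕ) {t : ℝ} (ht : 0 < t) (ht1 : t ≤ 1) :
    IsGKK (toComplex (matA n k t)) := by
  have hw : 0 < k + 2 := by omega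
  have hminor : ∀ α : Finset (Fin n), minorDet (toComplex (matA n k t)) α α rfl =
      ((t ^ (windows (k + 2) (α.map Fin.valEmbedding)).card : ℝ) : ℂ) := by
    intro α
    rw [matA, minorDet_toComplex_toepHess,
      hessDet_eq_pow_card_windows _ hw t (hessSeq_coeffA k t)]
  refine isGKK_of_koteljanskii _ (fun α => ?_) (fun γ i j hi hj hij => ?_)
  · rw [hminor, Complex.zero_lt_real]
    positivity
  · rw [hminor, hminor, hminor, hminor, ← Complex.ofReal_mul, ← Complex.ofReal_mul,
      Complex.real_le_real, ← pow_add, ← pow_add]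
    apply pow_le_pow_of_le_one ht.le ht1
    simp only [Finset.map_insert, Fin.valEmbedding_apply]
    exact card_windows_supermodular hw _ _ _ (fun h => hij (Fin.ext h))

/-! ### Generating functions of the leading minors. -/

section PowerSeries
open PowerSeries

/-- Laplace expansion along the first row is a convolution recurrence, here written as an identity
of power series. -/
theorem mk_hessSeq {R : Type*} [CommRing R] (c : ℕ → R) :
    (mk (hessSeq c) : R⟦X⟧) * (1 - X * mk fun j => (-1) ^ j * c j) = 1 := by
  have : (mk (hessSeq c) : R⟦X⟧) = 1 + X * ((mk fun j => (-1) ^ j * c j) * mk (hessSeq c)) := by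
    ext m
    rcases m with _ | m
    · simp
    · rw [map_add, coeff_succ_X_mul, coeff_mul, coeff_mk, hessSeq_succ,
        Finset.Nat.sum_antidiagonal_eq_sum_range_succ_mk]
      simp [coeff_one]
  linear_combination this

variable (k : ℕ) (a : ℕ → ℝ) (x t : ℝ)

theorem mk_hessSeq_firstRow :
    (mk (hessSeq (firstRow k a x)) : ℝ⟦X⟧) = mk (hessSeq (firstRow k a 0))
      - C x * (X * (mk (hessSeq (firstRow k a 0)) * mk (hessSeq (firstRow k a x)))) := by
  have h0 := mk_hessSeq (firstRow k a 0)
  have hx := mk_hessSeq (firstRow k a x)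
  have hE : (mk fun j => (-1) ^ j * firstRow k a x j : ℝ⟦X⟧) =
      (mk fun j => (-1) ^ j * firstRow k a 0 j) - C x := by
    ext j
    rcases j with _ | j <;> simp [firstRow]
  rw [hE] at hx
  linear_combination (mk (hessSeq (firstRow k a 0))) * hx - (mk (hessSeq (firstRow k a x))) * h0

theorem hessSeq_firstRow_succ (m : ℕ) :
    hessSeq (firstRow k a x) (m + 1) = hessSeq (firstRow k a 0) (m + 1) -
      x * ∑ p ∈ Finset.HasAntidiagonal.antidiagonal m,
        hessSeq (firstRow k a 0) p.1 * hessSeq (firstRow k a x) p.2 := by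
  have h := congrArg (coeff (m + 1)) (mk_hessSeq_firstRow k a x)
  rw [map_sub, coeff_C_mul, coeff_succ_X_mul, coeff_mul] at h
  simpa only [coeff_mk] using h

/-- Multiplying the relation between H_x and H_0 by 1 − tX makes the unperturbed part on the right
vanish for `coeffA` as soon as the minors at x = 0 are geometric with ratio t. -/
theorem hessSeq_firstRow_succ_sub (m : ℕ) :
    hessSeq (firstRow k a x) (m + 1) - t * hessSeq (firstRow k a x) m =
      hessSeq (firstRow k a 0) (m + 1) - t * hessSeq (firstRow k a 0) m -
      x * ∑ p ∈ Finset.HasAntidiagonal.antidiagonal m,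
        coeff p.1 ((1 - C t * X) * (mk (hessSeq (firstRow k a 0)))) *
          hessSeq (firstRow k a x) p.2 := by
  have h := congrArg (fun f => coeff (m + 1) ((1 - C t * X) * f)) (mk_hessSeq_firstRow k a x)
  have e : ((1 - C t * X) * (mk (hessSeq (firstRow k a 0))
      - C x * (X * (mk (hessSeq (firstRow k a 0)) * mk (hessSeq (firstRow k a x))))) : ℝ⟦X⟧) =
      (1 - C t * X) * mk (hessSeq (firstRow k a 0)) -
      C x * (X * (((1 - C t * X) * mk (hessSeq (firstRow k a 0))) *
        mk (hessSeq (firstRow k a x)))) := by ring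
  have e2 : ∀ f : ℝ⟦X⟧, coeff (m + 1) ((1 - C t * X) * f) = coeff (m + 1) f - t * coeff m f := by
    intro f
    rw [sub_mul, one_mul, mul_assoc, map_sub, coeff_C_mul, coeff_succ_X_mul]
  simp only [e] at h
  rw [map_sub, coeff_C_mul, coeff_succ_X_mul, e2, e2, coeff_mul] at h
  simpa only [coeff_mk] using h

theorem coeff_one_sub_mul_hessSeq_nonneg {t : ℝ} (ht : 0 < t) (ht1 : t ≤ 1) (i : ℕ) :
    0 ≤ coeff i ((1 - C t * X) * (mk (hessSeq (firstRow k (coeffA k t) 0)) : ℝ⟦X⟧)) := by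
  rcases i with _ | i
  · simp
  · rw [sub_mul, one_mul, mul_assoc, map_sub, coeff_C_mul, coeff_succ_X_mul, coeff_mk, coeff_mk,
      hessSeq_coeffA, hessSeq_coeffA, sub_nonneg, ← pow_succ']
    exact pow_le_pow_of_le_one ht.le ht1 (by omega)

end PowerSeries

/-! ### Least real zeros and eigenvalue monotonicity. -/

theorem continuous_hessSeq_firstRow (k : ℕ) (a : ℕ → ℝ) (m : ℕ) :
    Continuous fun x : ℝ => hessSeq (firstRow k a x) m := by
  unfold hessSeq
  apply Continuous.matrix_det
  refine continuous_pi fun i => continuous_pi fun j => ?_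
  simp only [hess, firstRow, Matrix.of_apply]
  split_ifs <;> fun_prop

/-- For x ≤ 0 the recurrence adds nonnegative terms to a positive power of t. This gives both l(A) ≥
0 and nonsingularity. -/
theorem hessSeq_coeffA_pos {k : ℕ} {t : ℝ} (ht : 0 < t) {x : ℝ} (hx : x ≤ 0) (m : ℕ) :
    0 < hessSeq (firstRow k (coeffA k t) x) m := by
  induction m using Nat.strong_induction_on with
  | _ m ih =>
    rcases m with _ | m
    · simp
    · rw [hessSeq_firstRow_succ, hessSeq_coeffA]
      have h1 : 0 ≤ ∑ p ∈ Finset.HasAntidiagonal.antidiagonal m, hessSeq (firstRow k (coeffA k t) 0) p.1 *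
          hessSeq (firstRow k (coeffA k t) x) p.2 := by
        apply Finset.sum_nonneg
        intro p hp
        rw [hessSeq_coeffA]
        have := Finset.HasAntidiagonal.mem_antidiagonal.1 hp
        exact mul_nonneg (by positivity) (ih _ (by omega)).le
      have h2 : 0 < t ^ (m + 1 + 1 - (k + 2)) := by positivity
      nlinarith [mul_nonneg (neg_nonneg.2 hx) h1]

/-- A real function that is positive on the nonpositive half-line and has no zero up to `x` is
positive up to `x`. -/
theorem pos_of_ne_zero_of_le {f : ℝ → ℝ} (hf : Continuous f) (h0 : ∀ x ≤ 0, 0 < f x) {x : ℝ}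
    (hx : ∀ y ≤ x, f y ≠ 0) : 0 < f x := by
  by_contra hneg
  have hneg := not_lt.1 hneg
  have h0x : 0 ≤ x := by
    by_contra h
    exact absurd (h0 x (not_le.1 h).le) (not_lt.2 hneg)
  obtain ⟨y, hy, hy'⟩ := intermediate_value_Icc' h0x hf.continuousOn ⟨hneg, (h0 0 le_rfl).le⟩
  exact hx y hy.2 hy'

theorem exists_isLeast_zero {f : ℝ → ℝ} (hf : Continuous f) (h0 : ∀ x ≤ 0, 0 < f x)
    (h : ∃ x, f x = 0) : ∃ x, IsLeast {x | f x = 0} x := by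
  have hb : BddBelow {x | f x = 0} := ⟨0, fun x hx => by
    by_contra h1
    exact (h0 x (not_le.1 h1).le).ne' hx⟩
  exact ⟨_, (isClosed_singleton.preimage hf).isLeast_csInf h hb⟩

/-- The characteristic functions of `A_{m,k,t}` have real zeros, and the least one decreases
with `m`. -/
theorem hessSeq_coeffA_zeros (k : ℕ) {t : ℝ} (ht : 0 < t) (ht1 : t ≤ 1) (m : ℕ) :
    (∃ x, hessSeq (firstRow k (coeffA k t) x) (m + 1) = 0) ∧
    ∀ x, (∀ y ≤ x, hessSeq (firstRow k (coeffA k t) y) (m + 1) ≠ 0) →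
      ∀ m' ≤ m + 1, ∀ y ≤ x, hessSeq (firstRow k (coeffA k t) y) m' ≠ 0 := by
  set p : ℕ → ℝ → ℝ := fun m x => hessSeq (firstRow k (coeffA k t) x) m with hp
  have hc : ∀ m, Continuous (p m) := continuous_hessSeq_firstRow k _
  have h0 : ∀ m, ∀ x ≤ 0, 0 < p m x := fun m x hx => hessSeq_coeffA_pos ht hx m
  change (∃ x, p (m + 1) x = 0) ∧ ∀ x, (∀ y ≤ x, p (m + 1) y ≠ 0) →
    ∀ m' ≤ m + 1, ∀ y ≤ x, p m' y ≠ 0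
  induction m with
  | zero =>
    have h1 : ∀ m' ≤ 1, ∀ y, p m' y = (1 - y) ^ m' := fun m' hm' y =>
      hessSeq_firstRow_eq_one k _ y m' (by omega)
    refine ⟨⟨1, by simp [h1]⟩, fun x hx m' hm' y hy => ?_⟩
    have h2 := hx y hy
    rw [zero_add, h1 _ le_rfl, pow_one] at h2
    rw [h1 _ hm']
    exact pow_ne_zero _ h2
  | succ m ih =>
    by_cases hm : m + 1 ≤ k
    · have h1 : ∀ m' ≤ m + 2, ∀ y, p m' y = (1 - y) ^ m' := fun m' hm' y =>
        hessSeq_firstRow_eq_one k _ y m' (by omega)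
      refine ⟨⟨1, by simp [h1]⟩, fun x hx m' hm' y hy => ?_⟩
      have h2 := hx y hy
      rw [h1 _ le_rfl] at h2
      rw [h1 _ hm']
      exact pow_ne_zero _ fun h => h2 (by rw [h, zero_pow (by omega)])
    · obtain ⟨hex, hall⟩ := ih
      obtain ⟨l, hl, hlmin⟩ := exists_isLeast_zero (hc (m + 1)) (h0 (m + 1)) hex
      have hl0 : 0 ≤ l := by
        by_contra h
        exact (h0 (m + 1) l (not_le.1 h).le).ne' hl
      -- To the left of the least zero l of p_{m+1}, all p_{m'} of order at most m + 1 are positive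
      -- by induction; nonnegativity at l follows by continuity.
      have hnn : ∀ m' ≤ m + 1, 0 ≤ p m' l := by
        intro m' hm'
        have hlt : ∀ y < l, 0 < p m' y := fun y hy =>
          pos_of_ne_zero_of_le (hc m') (h0 m') (hall y (fun z hz hz' =>
            absurd (hlmin hz') (by linarith)) m' hm')
        have hcl : l ∈ closure (Set.Iio l) := by simp
        exact closure_minimal (t := {y | 0 ≤ p m' y}) (fun y hy => (hlt y hy).le)
          (isClosed_Ici.preimage (hc m')) hcl
      -- Since m + 1 > k, the minors of orders m + 1 and m + 2 at x = 0 have ratio exactly t, so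
      -- p_{m+2}(l) is −l times a sum of nonnegative terms.
      have hle : p (m + 2) l ≤ 0 := by
        have h := hessSeq_firstRow_succ_sub k (coeffA k t) l t (m + 1)
        rw [hessSeq_coeffA, hessSeq_coeffA, ← pow_succ',
          show m + 1 + 1 - (k + 2) + 1 = m + 1 + 1 + 1 - (k + 2) by omega, sub_self, zero_sub] at h
        have hl' : hessSeq (firstRow k (coeffA k t) l) (m + 1) = 0 := hl
        rw [hl', mul_zero, sub_zero] at h
        change hessSeq (firstRow k (coeffA k t) l) (m + 1 + 1) ≤ 0
        rw [h, neg_nonpos]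
        refine mul_nonneg hl0 (Finset.sum_nonneg fun q hq => mul_nonneg
          (coeff_one_sub_mul_hessSeq_nonneg k ht ht1 _) (hnn _ ?_))
        have := Finset.HasAntidiagonal.mem_antidiagonal.1 hq
        omega
      refine ⟨?_, fun x hx => ?_⟩
      · by_contra hno
        exact absurd (pos_of_ne_zero_of_le (hc (m + 2)) (h0 (m + 2)) (x := l)
          fun y _ hy => hno ⟨y, hy⟩) (not_lt.2 hle)
      · have hxl : x < l := by
          by_contra h
          exact absurd (pos_of_ne_zero_of_le (hc (m + 2)) (h0 (m + 2)) (x := l)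
            fun y hy => hx y (hy.trans (not_lt.1 h))) (not_lt.2 hle)
        intro m' hm' y hy
        rcases Nat.lt_or_ge m' (m + 2) with h | h
        · exact hall x (fun z hz hz' => absurd (hlmin hz') (by linarith)) m' (by omega) y hy
        · have : m' = m + 2 := by omega
          exact this ▸ hx y hy

/-- The order m' is the length of the maximal run of S containing the given interval. It does not
depend on c, so the same factor serves for every spectral parameter. -/
theorem exists_hessSeq_dvd_hessDet {S : Finset ℕ} :
    ∀ {p m : ℕ}, 0 < m → Finset.Ico p (p + m) ⊆ S →
      ∃ m', m ≤ m' ∧ ∀ c : ℕ → ℝ, hessSeq c m' ∣ hessDet c S := by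
  induction S using Finset.interval_induction with
  | empty =>
    intro p m hm h
    have : p ∈ (∅ : Finset ℕ) := h (by simp [hm])
    simp at this
  | step q r S hr hS ih =>
    intro p m hm h
    have hp : p ∈ Finset.Ico q (q + r) ∪ S := h (by simp [hm])
    by_cases hpr : p < q + r
    · have hpq : q ≤ p := by
        rcases Finset.mem_union.1 hp with h1 | h1
        · exact (Finset.mem_Ico.1 h1).1
        · have := hS _ h1; omega
      refine ⟨r, ?_, fun c => ?_⟩
      · by_contra hmr
        have h1 : q + r ∈ Finset.Ico q (q + r) ∪ S := h (by simp; omega)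
        rcases Finset.mem_union.1 h1 with h1 | h1
        · simp at h1
        · have := hS _ h1; omega
      · rw [hessDet_Ico_union c q r S hS]
        exact dvd_mul_right _ _
    · obtain ⟨m', hm', hd⟩ := ih hm (p := p) (by
        intro y hy
        have h1 := Finset.mem_Ico.1 hy
        rcases Finset.mem_union.1 (h hy) with h2 | h2
        · have := Finset.mem_Ico.1 h2; omega
        · exact h2)
      refine ⟨m', hm', fun c => ?_⟩
      rw [hessDet_Ico_union c q r S hS]
      exact (hd c).mul_left _

theorem hessDet_ne_zero_of_Ico {c : ℕ → ℝ} {S : Finset ℕ}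
    (h : ∀ p m, 0 < m → Finset.Ico p (p + m) ⊆ S → hessSeq c m ≠ 0) : hessDet c S ≠ 0 := by
  induction S using Finset.interval_induction with
  | empty => simp
  | step q r S hr hS ih =>
    rw [hessDet_Ico_union c q r S hS]
    exact mul_ne_zero (h q r hr Finset.subset_union_left)
      (ih fun p m hm hS' => h p m hm (hS'.trans Finset.subset_union_right))

/-- Eigenvalue monotonicity for the principal submatrices of `A_{n,k,t}`. -/
theorem exists_hessDet_eq_zero_le {k : ℕ} {t : ℝ} (ht : 0 < t) (ht1 : t ≤ 1) {S T : Finset ℕ}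
    (hTS : T ⊆ S) {x : ℝ} (hx : hessDet (firstRow k (coeffA k t) x) T = 0) :
    ∃ y ≤ x, hessDet (firstRow k (coeffA k t) y) S = 0 := by
  by_contra! hno
  refine hessDet_ne_zero_of_Ico (fun p m hm hpm => ?_) hx
  obtain ⟨m', hm', hd⟩ := exists_hessSeq_dvd_hessDet hm (hpm.trans hTS)
  obtain ⟨m', rfl⟩ : ∃ r, m' = r + 1 := ⟨m' - 1, by omega⟩
  -- A run of T sits in a run of S that is at least as long; the latter has no zero up to x, so
  -- neither has the former.
  exact (hessSeq_coeffA_zeros k ht ht1 m').2 x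
    (fun y hy h => hno y hy (by simpa [h] using hd (firstRow k (coeffA k t) y))) m hm' x le_rfl

theorem exists_hessDet_eq_zero {k : ℕ} {t : ℝ} (ht : 0 < t) (ht1 : t ≤ 1) {S : Finset ℕ}
    (hS : S.Nonempty) : ∃ x, hessDet (firstRow k (coeffA k t) x) S = 0 := by
  obtain ⟨p, hp⟩ := hS
  obtain ⟨m', hm', hd⟩ := exists_hessSeq_dvd_hessDet (p := p) (S := S) one_pos (by simpa using hp)
  obtain ⟨m', rfl⟩ : ∃ r, m' = r + 1 := ⟨m' - 1, by omega⟩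
  obtain ⟨x, hx⟩ := (hessSeq_coeffA_zeros k ht ht1 m').1
  exact ⟨x, by simpa [hx] using hd (firstRow k (coeffA k t) x)⟩

theorem nonneg_of_mem_realSpectrum_matA {n k : ℕ} {t : ℝ} (ht : 0 < t) {x : ℝ}
    (hx : x ∈ realSpectrum (toComplex (matA n k t))) : 0 ≤ x := by
  rw [matA, mem_realSpectrum_toComplex_toepHess] at hx
  by_contra h
  exact (hessSeq_coeffA_pos ht (not_le.1 h).le n).ne' hx

/-- The matrices `A_{n,k,t}` are `τ`-matrices for all `t ∈ (0, 1]`. -/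
theorem isTauMatrix_matA (n k : ℕ) {t : ℝ} (ht : 0 < t) (ht1 : t ≤ 1) :
    IsTauMatrix (toComplex (matA n k t)) := by
  refine ⟨fun α β hβ hβα => ⟨?_, ?_⟩, ?_⟩
  · refine le_sInf ?_
    rintro _ ⟨x, hx, rfl⟩
    rw [matA, mem_realSpectrum_subMat] at hx
    obtain ⟨y, hyx, hy⟩ := exists_hessDet_eq_zero_le ht ht1 (Finset.map_subset_map.2 hβα) hx
    rw [← mem_realSpectrum_subMat] at hy
    exact (sInf_le (Set.mem_image_of_mem _ hy)).trans (EReal.coe_le_coe_iff.2 hyx)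
  · obtain ⟨x, hx⟩ := exists_hessDet_eq_zero (k := k) ht ht1 (hβ.map (f := Fin.valEmbedding))
    rw [← mem_realSpectrum_subMat] at hx
    exact (sInf_le (Set.mem_image_of_mem _ hx)).trans_lt (EReal.coe_lt_top x)
  · refine le_sInf ?_
    rintro _ ⟨x, hx, rfl⟩
    exact EReal.coe_nonneg.2 (nonneg_of_mem_realSpectrum_matA ht hx)

theorem exists_isLeast_realSpectrum_matA (n k : ℕ) {t : ℝ} (ht : 0 < t) (ht1 : t ≤ 1) :
    ∃ l, 0 ≤ l ∧ IsLeast (realSpectrum (toComplex (matA (n + 1) k t))) l := by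
  obtain ⟨l, hl⟩ := exists_isLeast_zero (continuous_hessSeq_firstRow k (coeffA k t) (n + 1))
    (fun x hx => hessSeq_coeffA_pos ht hx _) (hessSeq_coeffA_zeros k ht ht1 n).1
  have h : realSpectrum (toComplex (matA (n + 1) k t)) =
      {x | hessSeq (firstRow k (coeffA k t) x) (n + 1) = 0} := by
    ext x
    exact mem_realSpectrum_toComplex_toepHess _ _ _ _
  exact ⟨l, nonneg_of_mem_realSpectrum_matA ht (h ▸ hl.1), h ▸ hl⟩

/-! ### Instability of `B_k`. -/

/-- The recurrence reads p_{k+3+i} = (1−z) p_{k+2+i} − p_{i+1} + p_i, and within the given range p_i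
and p_{i+1} are still pure powers of 1 − z. The value at z = 0 also identifies the limit t → 0. For
i = 0 the truncated exponent is harmless because of its factor i. -/
theorem hessSeq_firstRow_matB {R : Type*} [CommRing R] (k : ℕ) (z : R) (i : ℕ) (hi : i ≤ k) :
    hessSeq (firstRow k (fun l => if l = 1 ∨ l = 2 then (-1) ^ k else 0) z) (k + 2 + i) =
      (1 - z) ^ (k + 2 + i) - (i + 1) * (1 - z) ^ i + i * (1 - z) ^ (i - 1) := by
  set c : ℕ → R := firstRow k (fun l => if l = 1 ∨ l = 2 then (-1) ^ k else 0) z with hc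
  have hsmall : ∀ m ≤ k + 1, hessSeq c m = (1 - z) ^ m := hessSeq_firstRow_eq_one k _ z
  have c0 : c 0 = 1 - z := by simp [hc, firstRow]
  have c1 : c (k + 1) = (-1) ^ k := by simp [hc, firstRow]
  have c2 : c (k + 2) = (-1) ^ k := by simp [hc, firstRow]
  have c3 : ∀ j, j ≠ 0 → j ≠ k + 1 → j ≠ k + 2 → c j = 0 := by
    intro j h0 h1 h2
    simp only [hc, firstRow, if_neg h0]
    split_ifs
    · omega
    · rfl
    · rfl
  have hsgn : ((-1 : R) ^ k) * (-1) ^ k = 1 := by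
    rw [← mul_pow]; simp
  induction i with
  | zero =>
    rw [add_zero, hessSeq_succ, Finset.sum_eq_add 0 (k + 1) (by omega)]
    · rw [c0, c1, Nat.sub_zero, Nat.sub_self, hsmall _ le_rfl]
      simp only [pow_zero, pow_succ, hessSeq_zero]
      linear_combination (-1 : R) * hsgn
    · intro j hj hj'
      rw [c3 j hj'.1 hj'.2 (by have := Finset.mem_range.1 hj; omega)]
      ring
    · simp
    · simp
  | succ i ih =>
    rw [← add_assoc, hessSeq_succ, Finset.sum_range_succ',
      Finset.sum_eq_add k (k + 1) (by omega)]
    · rw [c0, c1, c2, Nat.sub_zero, ih (by omega), show k + 2 + i - (k + 1) = i + 1 by omega,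
        show k + 2 + i - (k + 1 + 1) = i by omega, hsmall _ (by omega), hsmall _ (by omega)]
      rcases i with _ | i
      · simp only [pow_zero, pow_succ, Nat.cast_zero, Nat.cast_one, zero_add, Nat.sub_self]
        linear_combination (1 - (1 - z)) * hsgn
      · simp only [Nat.add_sub_cancel, pow_succ, pow_add, Nat.cast_add, Nat.cast_one]
        linear_combination ((1 - z) ^ i * (1 - z) - (1 - z) ^ i * (1 - z) * (1 - z)) * hsgn
    · intro j hj hj'
      rw [c3 (j + 1) (by omega) (by omega) (by omega)]
      ring
    · intro h; exact absurd (Finset.mem_range.2 (by omega)) h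
    · intro h; exact absurd (Finset.mem_range.2 (by omega)) h

open Polynomial in
/-- A polynomial with all roots in the closed left half-plane is at least as large at a point of
the right half-plane as at its reflection in the imaginary axis. -/
theorem norm_eval_neg_conj_le {P : ℂ[X]} (h : ∀ r ∈ P.roots, r.re ≤ 0) {w : ℂ} (hw : 0 ≤ w.re) :
    ‖P.eval (-(starRingEnd ℂ) w)‖ ≤ ‖P.eval w‖ := by
  have hn : ∀ s : Multiset ℂ, ‖s.prod‖ = (s.map fun z => ‖z‖).prod := fun s =>
    map_multiset_prod (normHom : ℂ →*₀ ℝ) s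
  rw [(IsAlgClosed.splits P).eval_eq_prod_roots, (IsAlgClosed.splits P).eval_eq_prod_roots, norm_mul,
    norm_mul, hn, hn, Multiset.map_map, Multiset.map_map]
  refine mul_le_mul_of_nonneg_left ?_ (norm_nonneg _)
  refine Multiset.prod_map_le_prod_map₀ _ _ (fun _ _ => norm_nonneg _) fun r hr => ?_
  have := h r hr
  simp only [Function.comp]
  rw [Complex.norm_def, Complex.norm_def]
  apply Real.sqrt_le_sqrt
  simp only [Complex.normSq_apply, Complex.sub_re, Complex.neg_re, Complex.conj_re, Complex.sub_im,
    Complex.neg_im, Complex.conj_im]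
  -- The difference of the squared distances to r is −4 Re w Re r ≥ 0.
  nlinarith [mul_nonneg hw (neg_nonneg.2 this)]

/-- Numerical bounds for `exp ((2 + b i) h)` with `b` close to `5π/2`. -/
theorem exp_mul_cos_sin_bounds {h b : ℝ} (hpos : 0 < h) (hle : h ≤ 1 / 24) (hb1 : 7.85 < b)
    (hb2 : b < 7.8541) :
    0 ≤ Real.exp (2 * h) * Real.cos (b * h) - 1 ∧ Real.exp (2 * h) * (1 - 2 * h) ≤ 1 ∧
    (1 + 2 * h) * (b * h * 0.973) ≤ Real.exp (2 * h) * Real.sin (b * h) ∧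
    (2 - Real.exp (2 * h) * Real.cos (b * h)) ^ 2 + (Real.exp (2 * h) * Real.sin (b * h)) ^ 2 ≤
      Real.exp (2.5 * h) := by
  have hbb : b ^ 2 < 61.7 := by nlinarith
  have hsq : h ^ 2 ≤ h / 24 := by nlinarith
  have hcube : h ^ 3 ≤ h / 576 := by nlinarith
  set E := Real.exp (2 * h) with hE
  have hEpos : 0 < E := Real.exp_pos _
  have hE1 : 1 + 2 * h ≤ E := by have := Real.add_one_le_exp (2 * h); linarith
  have hE2 : E * (1 - 2 * h) ≤ 1 := by
    have h1 := Real.add_one_le_exp (-(2 * h))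
    have h2 : E * Real.exp (-(2 * h)) = 1 := by rw [hE, ← Real.exp_add]; simp
    have h3 := mul_le_mul_of_nonneg_left h1 hEpos.le
    linarith
  -- 19.2 is the least c with (1 + 4h + ch²)(1 − 4h) ≥ 1 for all 0 < h ≤ 1/24.
  have hE3 : E ^ 2 ≤ 1 + 4 * h + 19.2 * h ^ 2 := by
    have h1 := Real.add_one_le_exp (-(4 * h))
    have h2 : E ^ 2 * Real.exp (-(4 * h)) = 1 := by
      rw [hE, ← Real.exp_nat_mul, ← Real.exp_add, ← Real.exp_zero]
      congr 1
      push_cast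
      ring
    have h3 := mul_le_mul_of_nonneg_left h1 (sq_nonneg E)
    have h5 : h ^ 3 ≤ h ^ 2 / 24 := by nlinarith [sq_nonneg h]
    have h4 : 1 ≤ (1 + 4 * h + 19.2 * h ^ 2) * (1 - 4 * h) := by
      have : (1 + 4 * h + 19.2 * h ^ 2) * (1 - 4 * h) = 1 + 3.2 * h ^ 2 - 76.8 * h ^ 3 := by ring
      linarith
    exact le_of_mul_le_mul_right (by linarith) (show 0 < 1 - 4 * h by linarith)
  have hθ0 : 0 < b * h := by positivity
  have hθ1 : b * h ≤ 0.328 := by nlinarith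
  have hsin : b * h * 0.973 ≤ Real.sin (b * h) := by
    have h1 := Real.sin_gt_sub_cube hθ0
    have h2 : (b * h) ^ 2 ≤ 0.328 ^ 2 := pow_le_pow_left₀ hθ0.le hθ1 2
    have h3 := mul_le_mul_of_nonneg_left h2 hθ0.le
    linarith
  have hcos : 1 - 30.85 * h ^ 2 ≤ Real.cos (b * h) := by
    have h1 : 1 - (b * h) ^ 2 / 2 ≤ Real.cos (b * h) := Real.one_sub_sq_div_two_le_cos
    have h2 : (b * h) ^ 2 ≤ 61.7 * h ^ 2 := by rw [mul_pow]; gcongr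
    linarith
  have hu : (1 + 2 * h) * (1 - 30.85 * h ^ 2) ≤ E * Real.cos (b * h) :=
    mul_le_mul hE1 hcos (by linarith) hEpos.le
  have hu2 : (1 + 2 * h) * (1 - 30.85 * h ^ 2) = 1 + 2 * h - 30.85 * h ^ 2 - 61.7 * h ^ 3 := by
    ring
  refine ⟨by linarith, hE2, mul_le_mul hE1 hsin (by positivity) hEpos.le, ?_⟩
  have h1 : (2 - E * Real.cos (b * h)) ^ 2 + (E * Real.sin (b * h)) ^ 2 =
      4 - 4 * (E * Real.cos (b * h)) + E ^ 2 := by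
    linear_combination E ^ 2 * Real.sin_sq_add_cos_sq (b * h)
  have h2 := Real.add_one_le_exp (2.5 * h)
  rw [h1]
  linarith

/-- Numerical bounds for `w = exp ((2 + 5πi/2) / N) - 1`. -/
theorem exp_sub_one_bounds (N : ℕ) (hN : 24 ≤ N) (w : ℂ)
    (hw : w = Complex.exp ((2 + 5 * Real.pi / 2 * Complex.I) / N) - 1) :
    0 ≤ w.re ∧ ((N : ℝ) - 2) * w.re ≤ 2 ∧ 7.5 ≤ ((N : ℝ) - 2) * w.im ∧
      ‖1 - (starRingEnd ℂ) w‖ ^ N < 4 := by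
  have hn : (24 : ℝ) ≤ N := by exact_mod_cast hN
  have hn0 : (0 : ℝ) < N := by linarith
  obtain ⟨h, hh⟩ : ∃ h : ℝ, h = 1 / N := ⟨_, rfl⟩
  have hNh : (N : ℝ) * h = 1 := by rw [hh]; field_simp
  have hpos : 0 < h := by rw [hh]; positivity
  have hle : h ≤ 1 / 24 := hh ▸ one_div_le_one_div_of_le (by norm_num) hn
  obtain ⟨b, hb⟩ : ∃ b : ℝ, b = 5 * Real.pi / 2 := ⟨_, rfl⟩
  have hb1 : 7.85 < b := by have := Real.pi_gt_d4; rw [hb]; linarith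
  have hb2 : b < 7.8541 := by have := Real.pi_lt_d4; rw [hb]; linarith
  have harg : ((2 + 5 * Real.pi / 2 * Complex.I) / N : ℂ) =
      ((2 * h : ℝ) : ℂ) + ((b * h : ℝ) : ℂ) * Complex.I := by
    rw [hb, hh]; push_cast; field_simp
  obtain ⟨h0, hE2, him1, hnorm⟩ := exp_mul_cos_sin_bounds hpos hle hb1 hb2
  have hre : w.re = Real.exp (2 * h) * Real.cos (b * h) - 1 := by
    rw [hw, harg, Complex.sub_re, Complex.exp_re]; simp
  have him : w.im = Real.exp (2 * h) * Real.sin (b * h) := by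
    rw [hw, harg, Complex.sub_im, Complex.exp_im]; simp
  refine ⟨hre ▸ h0, ?_, ?_, ?_⟩
  · have h1 : w.re ≤ Real.exp (2 * h) - 1 := by
      rw [hre]
      have := mul_le_mul_of_nonneg_left (Real.cos_le_one (b * h)) (Real.exp_pos (2 * h)).le
      linarith
    have h2 := mul_le_mul_of_nonneg_left h1 (show (0 : ℝ) ≤ N - 2 by linarith)
    have h3 : ((N : ℝ) - 2) * (Real.exp (2 * h) - 1) =
        N * (Real.exp (2 * h) * (1 - 2 * h) - 1) + 2 := by
      linear_combination (2 * Real.exp (2 * h)) * hNh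
    have h4 := mul_nonneg hn0.le (sub_nonneg.2 hE2)
    linarith
  · rw [him]
    have h2 := mul_le_mul_of_nonneg_left him1 (show (0 : ℝ) ≤ N - 2 by linarith)
    have h3 : ((N : ℝ) - 2) * ((1 + 2 * h) * (b * h * 0.973)) = (1 - 4 * h ^ 2) * b * 0.973 := by
      linear_combination ((1 + 2 * h) * (b * 0.973)) * hNh
    rw [h3] at h2
    refine le_trans ?_ h2
    have h4 : 4 * h ^ 2 ≤ 0.007 := by nlinarith
    nlinarith
  · have h1 : ‖1 - (starRingEnd ℂ) w‖ ^ 2 ≤ Real.exp (2.5 * h) := by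
      rw [← Complex.normSq_eq_norm_sq, Complex.normSq_apply]
      simp only [Complex.sub_re, Complex.one_re, Complex.conj_re, Complex.sub_im, Complex.one_im,
        Complex.conj_im]
      rw [hre, him]
      refine le_trans (le_of_eq ?_) hnorm
      ring
    -- The N-th power is at most e^{5/4} < 4; the fourth power makes the exponents integers.
    have h3 : (‖1 - (starRingEnd ℂ) w‖ ^ N) ^ 4 ≤ Real.exp 1 ^ 5 := by
      calc (‖1 - (starRingEnd ℂ) w‖ ^ N) ^ 4 = (‖1 - (starRingEnd ℂ) w‖ ^ 2) ^ (2 * N) := by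
            rw [← pow_mul, ← pow_mul]; congr 1; ring
        _ ≤ Real.exp (2.5 * h) ^ (2 * N) := pow_le_pow_left₀ (by positivity) h1 _
        _ = Real.exp 1 ^ 5 := by
            rw [← Real.exp_nat_mul, ← Real.exp_nat_mul]
            congr 1
            push_cast
            linear_combination 5 * hNh
    have h4 : Real.exp 1 ^ 5 < 4 ^ 4 := by
      calc Real.exp 1 ^ 5 < 2.72 ^ 5 :=
            pow_lt_pow_left₀ (by have := Real.exp_one_lt_d9; linarith) (Real.exp_pos _).le
              (by norm_num)
        _ < 4 ^ 4 := by norm_num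
    exact lt_of_pow_lt_pow_left₀ 4 (by norm_num) (h3.trans_lt h4)

open Polynomial in
/-- The trinomial `μ ^ N - (N - 2) μ + (N - 3)` has a zero with real part larger than `1`. -/
theorem exists_trinomial_zero (N : ℕ) (hN : 24 ≤ N) :
    ∃ μ : ℂ, μ ^ N - ((N : ℂ) - 2) * μ + ((N : ℂ) - 3) = 0 ∧ 1 < μ.re := by
  set P : ℂ[X] := (1 + X) ^ N - 1 - C ((N : ℂ) - 2) * X with hP
  have heval : ∀ z, P.eval z = (1 + z) ^ N - 1 - ((N : ℂ) - 2) * z := by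
    intro z; simp [hP]
  by_contra! hno
  have hroots : ∀ r ∈ P.roots, r.re ≤ 0 := by
    intro r hr
    have h1 : P.eval r = 0 := (mem_roots'.1 hr).2
    rw [heval] at h1
    have h2 := hno (1 + r) (by linear_combination h1)
    simpa using h2
  -- With this w, (1 + w)^N = i e² points along the imaginary axis and cancels about 7.39 of (N−2)
  -- Im w in P(w). The angle is 5π/2, not π/2, so that (N−2) Im w, roughly 5π/2, still exceeds e².
  obtain ⟨w, hw⟩ : ∃ w, w = Complex.exp ((2 + 5 * Real.pi / 2 * Complex.I) / N) - 1 := ⟨_, rfl⟩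
  obtain ⟨h0, hx, hy, hpow⟩ := exp_sub_one_bounds N hN w hw
  have hle := norm_eval_neg_conj_le hroots h0
  have hN0 : (N : ℂ) ≠ 0 := by exact_mod_cast (show N ≠ 0 by omega)
  have hwN : (1 + w) ^ N = ((Real.exp 2 : ℝ) : ℂ) * Complex.I := by
    have h1 : (5 * Real.pi / 2 * Complex.I : ℂ) =
        (Real.pi / 2 * Complex.I : ℂ) + 2 * Real.pi * Complex.I := by ring
    rw [hw, add_sub_cancel, ← Complex.exp_nat_mul, mul_div_cancel₀ _ hN0, Complex.exp_add, h1,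
      Complex.exp_add, Complex.exp_two_pi_mul_I, Complex.exp_pi_div_two_mul_I]
    push_cast
    ring
  have he1 : 7.38 < Real.exp 2 := by
    have h1 := Real.exp_one_gt_d9
    have h2 : Real.exp 2 = Real.exp 1 * Real.exp 1 := by rw [← Real.exp_add]; norm_num
    nlinarith
  have he2 : Real.exp 2 < 7.5 := by
    have h1 := Real.exp_one_lt_d9
    have h2 : Real.exp 2 = Real.exp 1 * Real.exp 1 := by rw [← Real.exp_add]; norm_num
    nlinarith [Real.exp_pos 1]
  have hn : (24 : ℝ) ≤ N := by exact_mod_cast hN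
  have hcast : ((N : ℂ) - 2) = (((N : ℝ) - 2 : ℝ) : ℂ) := by push_cast; rfl
  have hup : ‖P.eval w‖ ≤ 3 + (((N : ℝ) - 2) * w.im - Real.exp 2) := by
    rw [heval, hwN, hcast]
    refine (Complex.norm_le_abs_re_add_abs_im _).trans ?_
    have h1 : (((Real.exp 2 : ℝ) : ℂ) * Complex.I - 1 - (((N : ℝ) - 2 : ℝ) : ℂ) * w).re =
        -1 - ((N : ℝ) - 2) * w.re := by
      rw [Complex.sub_re, Complex.sub_re, Complex.re_ofReal_mul, Complex.re_ofReal_mul]; simp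
    have h2 : (((Real.exp 2 : ℝ) : ℂ) * Complex.I - 1 - (((N : ℝ) - 2 : ℝ) : ℂ) * w).im =
        Real.exp 2 - ((N : ℝ) - 2) * w.im := by
      rw [Complex.sub_im, Complex.sub_im, Complex.im_ofReal_mul, Complex.im_ofReal_mul]; simp
    rw [h1, h2, abs_of_nonpos, abs_of_nonpos]
    · linarith
    · linarith
    · nlinarith
  -- At the reflected point the power has modulus below 4 and the linear term dominates. The upper
  -- bound at w is (N−2) Im w + 3 − e², and e² > 7.38 makes it smaller than this lower bound.
  have hlow : ((N : ℝ) - 2) * w.im - 4 < ‖P.eval (-(starRingEnd ℂ) w)‖ := by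
    rw [heval, hcast]
    set v : ℂ := -1 - (((N : ℝ) - 2 : ℝ) : ℂ) * -(starRingEnd ℂ) w with hv
    have h1 : v.im = -(((N : ℝ) - 2) * w.im) := by
      rw [hv, Complex.sub_im, Complex.im_ofReal_mul]; simp
    have h2 : ((N : ℝ) - 2) * w.im ≤ ‖v‖ := by
      refine le_trans ?_ (Complex.abs_im_le_norm v)
      rw [h1, abs_neg]
      exact le_abs_self _
    have h3 : ‖v‖ ≤ ‖(1 + -(starRingEnd ℂ) w) ^ N - 1 - (((N : ℝ) - 2 : ℝ) : ℂ) * -(starRingEnd ℂ) w‖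
        + ‖(1 - (starRingEnd ℂ) w) ^ N‖ := by
      refine le_trans (le_of_eq ?_) (norm_sub_le _ _)
      congr 1
      rw [hv]; ring
    rw [norm_pow] at h3
    linarith
  linarith

/-- `B_k` has an eigenvalue with negative real part. -/
theorem exists_mem_spectrum_matB (k : ℕ) (hk : 20 < k) :
    ∃ z ∈ spectrum ℂ (toComplex (matB k)), z.re < 0 := by
  obtain ⟨μ, hμ, hre⟩ := exists_trinomial_zero (k + 3) (by omega)
  refine ⟨1 - μ, ?_, by simpa using hre⟩
  rw [matB, mem_spectrum_toComplex_toepHess]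
  have h := hessSeq_firstRow_matB k (1 - μ) k le_rfl
  have hc : (fun l => (((if l = 1 ∨ l = 2 then (-1) ^ k else 0 : ℝ)) : ℂ)) =
      fun l => if l = 1 ∨ l = 2 then (-1) ^ k else 0 := by
    ext l; split_ifs <;> simp
  rw [hc, show 2 * k + 2 = k + 2 + k by ring, h, sub_sub_cancel]
  obtain ⟨m, rfl⟩ : ∃ m, k = m + 1 := ⟨k - 1, by omega⟩
  rw [Nat.add_sub_cancel]
  push_cast at hμ ⊢
  -- The characteristic polynomial is μ^{k−1} times the trinomial with N = k + 3.
  linear_combination μ ^ m * hμ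

/-! ### The limit t → 0 and persistence of instability. -/

theorem continuous_toepHess (n k : ℕ) {a : ℝ → ℕ → ℝ} (ha : ∀ l, Continuous fun t => a t l) :
    Continuous fun t => toepHess n k (a t) := by
  refine continuous_pi fun i => continuous_pi fun j => ?_
  simp only [toepHess]
  split_ifs
  · exact continuous_const
  · exact ha _
  · exact continuous_const

theorem continuous_coeffA (k j : ℕ) : Continuous fun t => coeffA k t j := by
  induction j using Nat.strong_induction_on with
  | _ j ih =>
    have h : (fun t => coeffA k t j) = fun t => (-1) ^ (k + j) * (t ^ j -
        (toepHess (k + j + 1) k (fun l => if _h : l < j then coeffA k t l else 0)).det) := by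
      ext t
      rw [coeffA.eq_1 k t j]
    rw [h]
    refine continuous_const.mul ((continuous_pow j).sub (Continuous.matrix_det ?_))
    refine continuous_toepHess _ _ fun l => ?_
    split_ifs with hl
    · exact ih l hl
    · exact continuous_const

/-- The first row of `B_k` gives leading minors 0 of orders k+2, …, 2k+2, which are the conditions
defining the a_j at t = 0. They hold only for j ≤ k + 1, so the uniqueness induction is repeated in
that range. -/
theorem coeffA_zero (k j : ℕ) (hj : 1 ≤ j) (hjk : j ≤ k + 1) :
    coeffA k 0 j = if j = 1 ∨ j = 2 then (-1) ^ k else 0 := by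
  induction j using Nat.strong_induction_on with
  | _ j ih =>
    set a : ℕ → ℝ := fun l => if l = 1 ∨ l = 2 then (-1) ^ k else 0
    have h1 : (toepHess (k + j + 1) k a).det = 0 ^ j := by
      obtain ⟨i, rfl⟩ : ∃ i, j = i + 1 := ⟨j - 1, by omega⟩
      have h := hessSeq_firstRow_matB k (0 : ℝ) i (by omega)
      rw [zero_pow (by omega), show k + (i + 1) + 1 = k + 2 + i by ring]
      have h' : (toepHess (k + 2 + i) k a).det = hessSeq (firstRow k a 0) (k + 2 + i) := by
        rw [hessSeq]
        congr 1
        ext p q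
        simpa using toepHess_apply_sub (RingHom.id ℝ) _ k a 0 p q
      rw [h', h]
      simp
    have h2 := det_toepHess_coeffA k 0 j hj
    rw [matA] at h2
    rw [det_toepHess_trunc k j hj] at h1 h2
    have h3 : toepHess (k + j + 1) k (fun l => if l < j then a l else 0) =
        toepHess (k + j + 1) k (fun l => if l < j then coeffA k 0 l else 0) := by
      ext p q
      simp only [toepHess]
      by_cases hpq : (p : ℕ) + k < q
      · by_cases hl : (q : ℕ) - p - k < j
        · simp only [hl, if_true]
          rw [ih _ hl (by omega) (by omega)]
        · simp only [hl, if_false]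
      · simp only [hpq, if_false]
    rw [h3] at h1
    have h4 : ((-1 : ℝ) ^ (k + j)) * coeffA k 0 j = (-1) ^ (k + j) * a j := by linarith
    exact mul_left_cancel₀ (pow_ne_zero _ (by norm_num)) h4

theorem matA_zero (k : ℕ) : matA (2 * k + 2) k 0 = matB k := by
  ext i j
  simp only [matA, matB, toepHess]
  split_ifs with h1 h2 h3
  · rfl
  · rw [coeffA_zero k _ (by omega) (by omega), if_pos h3]
  · rw [coeffA_zero k _ (by omega) (by omega), if_neg h3]
  · rfl

theorem tendsto_matA (k : ℕ) :
    Filter.Tendsto (fun t : ℝ => matA (2 * k + 2) k t) (𝓝[>] 0) (𝓝 (matB k)) := by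
  have h : Continuous fun t : ℝ => matA (2 * k + 2) k t :=
    continuous_toepHess _ k (continuous_coeffA k)
  rw [← matA_zero]
  exact (h.tendsto 0).mono_left nhdsWithin_le_nhds

/-- If no eigenvalue of `M` has negative real part, then the characteristic polynomial is bounded
below on the open left half-plane. -/
theorem abs_re_pow_le_norm_eval_charpoly {n : ℕ} (M : Matrix (Fin n) (Fin n) ℂ)
    (h : ∀ z ∈ spectrum ℂ M, 0 ≤ z.re) {z : ℂ} (hz : z.re ≤ 0) :
    |z.re| ^ n ≤ ‖M.charpoly.eval z‖ := by
  have hs := IsAlgClosed.splits M.charpoly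
  have hn : ∀ s : Multiset ℂ, ‖s.prod‖ = (s.map fun z => ‖z‖).prod := fun s =>
    map_multiset_prod (normHom : ℂ →*₀ ℝ) s
  have hcard : M.charpoly.roots.card = n := by
    rw [← hs.natDegree_eq_card_roots, Matrix.charpoly_natDegree_eq_dim, Fintype.card_fin]
  rw [hs.eval_eq_prod_roots_of_monic M.charpoly_monic, hn, Multiset.map_map]
  calc |z.re| ^ n = (M.charpoly.roots.map fun _ => |z.re|).prod := by
        rw [Multiset.map_const', Multiset.prod_replicate, hcard]
    _ ≤ _ := by
        refine Multiset.prod_map_le_prod_map₀ _ _ (fun _ _ => abs_nonneg _) fun r hr => ?_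
        have h1 := h r (Matrix.mem_spectrum_of_isRoot_charpoly (Polynomial.mem_roots'.1 hr).2)
        refine le_trans ?_ (Complex.abs_re_le_norm (z - r))
        rw [Complex.sub_re, abs_of_nonpos hz, abs_of_nonpos (by linarith)]
        linarith

theorem exists_unstable_matA (k : ℕ) (hk : 20 < k) :
    ∃ t₀ : ℝ, 0 < t₀ ∧ t₀ < 1 ∧ ∀ t : ℝ, 0 < t → t < t₀ →
      ∃ z ∈ spectrum ℂ (toComplex (matA (2 * k + 2) k t)), z.re < 0 := by
  obtain ⟨z, hz, hre⟩ := exists_mem_spectrum_matB k hk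
  -- Instead of continuity of roots, the characteristic polynomial is followed at one fixed
  -- eigenvalue z of `B_k`: its value tends to 0, while stability would keep it at least |Re
  -- z|^{2k+2}.
  have hc : Continuous fun t : ℝ => ‖(toComplex (matA (2 * k + 2) k t)).charpoly.eval z‖ := by
    simp only [Matrix.eval_charpoly]
    refine (Continuous.matrix_det (continuous_const.sub ?_)).norm
    exact (continuous_toepHess _ k (continuous_coeffA k)).matrix_map Complex.continuous_ofReal
  have h0 : ‖(toComplex (matA (2 * k + 2) k 0)).charpoly.eval z‖ < |z.re| ^ (2 * k + 2) := by
    have h1 : (toComplex (matB k)).charpoly.eval z = 0 :=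
      Matrix.mem_spectrum_iff_isRoot_charpoly.1 hz
    rw [matA_zero, h1, norm_zero]
    exact pow_pos (abs_pos.2 hre.ne) _
  obtain ⟨ε, hε, hball⟩ := Metric.eventually_nhds_iff.1
    ((hc.tendsto 0).eventually (gt_mem_nhds h0))
  refine ⟨min ε (1 / 2), by positivity, (min_le_right _ _).trans_lt (by norm_num), fun t ht ht' => ?_⟩
  by_contra! hno
  refine absurd (abs_re_pow_le_norm_eval_charpoly _ hno hre.le) (not_le.2 (hball ?_))
  rw [Real.dist_eq, sub_zero, abs_of_pos ht]
  exact ht'.trans_le (min_le_left _ _)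

/-! ### Refutation of the conjectures. -/

theorem isUnit_det_matA (n k : ℕ) {t : ℝ} (ht : 0 < t) : IsUnit (toComplex (matA n k t)).det := by
  have h := spectrum.zero_notMem_iff ℂ (a := toComplex (matA n k t))
  have h0 : (0 : ℝ) ∉ realSpectrum (toComplex (matA n k t)) := by
    rw [matA, mem_realSpectrum_toComplex_toepHess]
    exact (hessSeq_coeffA_pos ht le_rfl n).ne'
  rw [← Matrix.isUnit_iff_isUnit_det, ← h]
  simpa [realSpectrum] using h0

/-- Since l(A) ≥ 0, an eigenvalue in the open left half-plane stays there after subtracting l(A), so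
its argument already exceeds π/2 in absolute value. -/
theorem not_satisfiesVargaBound_matA (n k : ℕ) {t : ℝ} (ht : 0 < t) (ht1 : t ≤ 1)
    (h : ∃ z ∈ spectrum ℂ (toComplex (matA (n + 1) k t)), z.re < 0) :
    ¬ SatisfiesVargaBound (toComplex (matA (n + 1) k t)) := by
  intro hV
  obtain ⟨z, hz, hre⟩ := h
  obtain ⟨l, hl0, hl⟩ := exists_isLeast_realSpectrum_matA n k ht ht1
  have h1 : |Complex.arg (z - l)| ≤ Real.pi / 2 :=
    (hV l hl z hz).trans (sub_le_self _ (div_nonneg Real.pi_pos.le (Nat.cast_nonneg _)))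
  have h2 := Complex.abs_arg_le_pi_div_two_iff.1 h1
  rw [Complex.sub_re, Complex.ofReal_re] at h2
  linarith

theorem mainTheorem3 :
    (∀ k : ℕ, 20 < k →
      (∃ t₀ : ℝ, 0 < t₀ ∧ t₀ < 1 ∧ ∀ t : ℝ, 0 < t → t < t₀ →
        IsGKK (toComplex (matA (2 * k + 2) k t)) ∧
        IsTauMatrix (toComplex (matA (2 * k + 2) k t)) ∧
        ∃ z ∈ spectrum ℂ (toComplex (matA (2 * k + 2) k t)), z.re < 0) ∧
      Filter.Tendsto (fun t : ℝ => matA (2 * k + 2) k t) (𝓝[>] 0) (𝓝 (matB k)) ∧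
      ∃ z ∈ spectrum ℂ (toComplex (matB k)), z.re < 0) ∧
    ¬ CarlsonConjecture ∧
    ¬ EngelSchneiderConjecture ∧
    ¬ VargaConjectureGKK ∧
    ¬ VargaConjectureTau ∧
    ¬ HershkowitzConjecture := by
  refine ⟨fun k hk => ⟨?_, tendsto_matA k, exists_mem_spectrum_matB k hk⟩, ?_⟩
  · obtain ⟨t₀, h0, h1, h⟩ := exists_unstable_matA k hk
    exact ⟨t₀, h0, h1, fun t ht ht' => ⟨isGKK_matA _ k ht (ht'.trans h1).le,
      isTauMatrix_matA _ k ht (ht'.trans h1).le, h t ht ht'⟩⟩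
  · obtain ⟨t₀, h0, h1, h⟩ := exists_unstable_matA 21 (by norm_num)
    have ht : 0 < t₀ / 2 := by linarith
    have ht1 : t₀ / 2 ≤ 1 := by linarith
    have hz := h (t₀ / 2) ht (by linarith)
    have hG := isGKK_matA (2 * 21 + 2) 21 ht ht1
    have hT := isTauMatrix_matA (2 * 21 + 2) 21 ht ht1
    have hU := isUnit_det_matA (2 * 21 + 2) 21 ht
    have hV := not_satisfiesVargaBound_matA (2 * 21 + 1) 21 ht ht1 hz
    have hS : ¬ IsPositiveStable (toComplex (matA (2 * 21 + 2) 21 (t₀ / 2))) := by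
      obtain ⟨z, hz, hre⟩ := hz
      exact fun hS => absurd (hS z hz) (not_lt.2 hre.le)
    exact ⟨fun H => hS (H _ _ hG), fun H => hS (H _ _ hT hU), fun H => hV (H _ _ (by norm_num) hG),
      fun H => hV (H _ _ (by norm_num) hT hU), fun H => hS (H _ _ hG hT)⟩
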